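/- Let $\mathcal E$ be the set of non-negative upper semicontinuous functions $f:[0,1]\to\mathbb R$, with the metric $\mathbb H(f,g)=d_H(H_f,H_g)$, where $d_H$ is the Hausdorff distance in the Euclidean plane and $H_f=\{(x,y): x\in[0,1],\ 0\le y\le f(x)\}$ is the hypograph of $f$; $\mathcal E$ carries its Borel $\sigma$-algebra. For a sample $D_n=((X_1,Y_1),\dots,(X_n,Y_n))$ of $\mathcal E\times\{0,1\}$-valued pairs, the $k$-NN classifier $g_n$ assigns to $x\in\mathcal E$ the label held by the majority of the $k=k_n$ observations $X_i$ that are $\mathbb H$-closest to $x$, ties (both between distances and in the vote) being broken uniformly at random, independently of everything else. Let $(k_n)$ be a sequence of natural numbers with $k_n\to\infty$ and $k_n/n\to0$. For every Borel probability measure $Q$ on $\mathcal E\times\{0,1\}$ and every neighbourhood $U$ of $Q$ in the weak topology there is a probability measure $P\in U$ such that, if $(X,Y)$ has law $P$, the regression function $\eta(x)=P(Y=1\mid X=x)$ has a version with values in $[0,1]$ that is continuous with compact support in $(\mathcal E,\mathbb H)$, and such that the sequence $(g_n)$ is weakly consistent under $P$: if $D_n$ consists of the first $n$ terms of an i.i.d.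 sequence with law $P$, independent of $(X,Y)$, then $$L_n=P(g_n(X)\ne Y\mid D_n)\longrightarrow L^*=P(g^*(X)\ne Y)\quad\text{in probability as } n\to\infty,\qquad\text{where } g^*(x)=\mathbb I_{\{\eta(x)>1/2\}}.$$ -/

import Mathlib

open Set Filter Topology MeasureTheory ProbabilityTheory

namespace VisualKNN

/-! ### The space of non-negative upper semicontinuous functions on `[0,1]` -/

/-- Non-negative upper semicontinuous functions `[0,1] → ℝ`. -/
structure UscFun where
  toFun : Icc (0 : ℝ) 1 → ℝ
  nonneg : ∀ t, 0 ≤ toFun t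
  usc : UpperSemicontinuous toFun

/-- The hypograph `{(x, y) : x ∈ [0,1], 0 ≤ y ≤ f x}` in the Euclidean plane. -/
def hypograph (f : UscFun) : Set (EuclideanSpace ℝ (Fin 2)) :=
  {p | ∃ h : p 0 ∈ Icc (0 : ℝ) 1, 0 ≤ p 1 ∧ p 1 ≤ f.toFun ⟨p 0, h⟩}

/-- The visual distance: the Hausdorff distance between the hypographs. -/
noncomputable def visualDist (f g : UscFun) : ℝ :=
  Metric.hausdorffDist (hypograph f) (hypograph g)

theorem mem_hypograph (f : UscFun) (t : Icc (0 : ℝ) 1) (y : ℝ) :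
    (!₂[(t : ℝ), y] : EuclideanSpace ℝ (Fin 2)) ∈ hypograph f ↔ 0 ≤ y ∧ y ≤ f.toFun t := by
  constructor
  · rintro ⟨h, h0, h1⟩
    exact ⟨by simpa using h0, by simpa using h1⟩
  · rintro ⟨h0, h1⟩
    exact ⟨by simp, by simpa using h0, by simpa using h1⟩

theorem hypograph_injective : Function.Injective hypograph := by
  have key : ∀ f g : UscFun, hypograph f = hypograph g → ∀ t, f.toFun t ≤ g.toFun t := by
    intro f g h t
    have h1 := (mem_hypograph f t (f.toFun t)).2 ⟨f.nonneg t, le_rfl⟩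
    rw [h] at h1
    exact ((mem_hypograph g t _).1 h1).2
  rintro ⟨f, hf, hf'⟩ ⟨g, hg, hg'⟩ h
  have : f = g := funext fun t => le_antisymm (key _ _ h t) (key _ _ h.symm t)
  subst this
  rfl

theorem hypograph_nonempty (f : UscFun) : (hypograph f).Nonempty :=
  ⟨_, (mem_hypograph f ⟨0, by simp⟩ 0).2 ⟨le_rfl, f.nonneg _⟩⟩

theorem isCompact_hypograph (f : UscFun) : IsCompact (hypograph f) := by
  obtain ⟨M, hM⟩ := (f.usc.upperSemicontinuousOn univ).bddAbove_of_isCompact isCompact_univ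
  have hc : IsCompact {q : Icc (0 : ℝ) 1 × ℝ | 0 ≤ q.2 ∧ q.2 ≤ f.toFun q.1} := by
    refine IsCompact.of_isClosed_subset (isCompact_univ.prod (isCompact_Icc (a := (0 : ℝ)) (b := M)))
      ((isClosed_le continuous_const continuous_snd).inter f.usc.IsClosed_hypograph) ?_
    rintro ⟨t, y⟩ ⟨h0, h1⟩
    exact ⟨mem_univ _, h0, h1.trans (hM ⟨t, mem_univ _, rfl⟩)⟩
  have himg : hypograph f = (fun q : Icc (0 : ℝ) 1 × ℝ =>
      (!₂[(q.1 : ℝ), q.2] : EuclideanSpace ℝ (Fin 2))) ''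
        {q : Icc (0 : ℝ) 1 × ℝ | 0 ≤ q.2 ∧ q.2 ≤ f.toFun q.1} := by
    ext p
    constructor
    · rintro ⟨h, h0, h1⟩
      refine ⟨(⟨p 0, h⟩, p 1), ⟨h0, h1⟩, ?_⟩
      ext i
      fin_cases i <;> simp
    · rintro ⟨⟨t, y⟩, h, rfl⟩
      exact (mem_hypograph f t y).2 h
  rw [himg]
  exact hc.image (by fun_prop)

/-- The metric on `UscFun`; its distance is `visualDist`. -/
noncomputable instance : MetricSpace UscFun :=
  MetricSpace.induced
    (fun f => (⟨⟨hypograph f, isCompact_hypograph f⟩, hypograph_nonempty f⟩ :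
      TopologicalSpace.NonemptyCompacts (EuclideanSpace ℝ (Fin 2))))
    (fun _ _ h => hypograph_injective
      (congrArg (fun K : TopologicalSpace.NonemptyCompacts (EuclideanSpace ℝ (Fin 2)) =>
        (K : Set (EuclideanSpace ℝ (Fin 2)))) h))
    inferInstance

theorem dist_eq_visualDist (f g : UscFun) : dist f g = visualDist f g := rfl

/-- The Borel sigma-algebra of the visual distance. -/
noncomputable instance : MeasurableSpace UscFun := borel UscFun

instance : BorelSpace UscFun := ⟨rfl⟩

/-! ### Binary classification: labels are Booleans, `true` is class `1`, `false` is class `0` -/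

section Classification

variable {𝒳 : Type*}

/-- `η` is a (`[0,1]`-valued) version of the regression function `x ↦ P(Y = 1 | X = x)` when
`(X, Y)` has law `P`. -/
def IsRegressionFunction [MeasurableSpace 𝒳] (P : Measure (𝒳 × Bool)) (η : 𝒳 → ℝ) : Prop :=
  (∀ x, η x ∈ Icc (0 : ℝ) 1) ∧
    (fun z : 𝒳 × Bool => η z.1) =ᵐ[P]
      P⟦{z : 𝒳 × Bool | z.2 = true} | MeasurableSpace.comap Prod.fst inferInstance⟧

open Classical in
/-- The optimal rule `1_{η(x) > 1/2}`. -/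
noncomputable def bayesRule (η : 𝒳 → ℝ) (x : 𝒳) : Bool := decide (1 / 2 < η x)

/-- The optimal misclassification probability `L* = P(g*(X) ≠ Y)`. -/
noncomputable def bayesRisk [MeasurableSpace 𝒳] (P : Measure (𝒳 × Bool)) (η : 𝒳 → ℝ) : ℝ :=
  P.real {z | bayesRule η z.1 ≠ z.2}

/-- Values of the auxiliary randomization for a training sample of size `n`: a random
permutation of the indices, that breaks ties between distances, and a fair coin, that breaks
ties in the majority vote. -/
abbrev TieBreaker (n : ℕ) : Type := Equiv.Perm (Fin n) × Bool

variable [PseudoMetricSpace 𝒳] {n : ℕ}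

/-- In the training sample `D`, the observation `j` comes strictly before `i` in the order of
the distances to `x`, ties being broken by `σ`. -/
def Closer (D : Fin n → 𝒳 × Bool) (σ : Equiv.Perm (Fin n)) (x : 𝒳) (j i : Fin n) : Prop :=
  dist (D j).1 x < dist (D i).1 x ∨ (dist (D j).1 x = dist (D i).1 x ∧ σ j < σ i)

open Classical in
/-- The (indices of the) `k` nearest neighbours of `x`: those observations that have fewer than
`k` predecessors. -/
noncomputable def nearest (k : ℕ) (D : Fin n → 𝒳 × Bool) (σ : Equiv.Perm (Fin n)) (x : 𝒳) :
    Finset (Fin n) :=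
  {i | Finset.card {j | Closer D σ x j i} < k}

/-- The number of the `k` nearest neighbours of `x` that have label `b`. -/
noncomputable def votes (k : ℕ) (D : Fin n → 𝒳 × Bool) (σ : Equiv.Perm (Fin n)) (x : 𝒳)
    (b : Bool) : ℕ :=
  Finset.card {i ∈ nearest k D σ x | (D i).2 = b}

/-- The `k`-NN classifier: majority vote among the `k` nearest neighbours, where the coin decides
if the vote is tied. -/
noncomputable def knn (k : ℕ) (D : Fin n → 𝒳 × Bool) (τ : TieBreaker n) (x : 𝒳) : Bool :=
  if votes k D τ.1 x true < votes k D τ.1 x false then false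
  else if votes k D τ.1 x false < votes k D τ.1 x true then true
  else τ.2

/-- The misclassification probability `L_n = P(g_n(X) ≠ Y | D_n)` at `D_n = D`: the new pair
`(X, Y)` has law `P`, and the tie breaker is uniformly distributed and independent of
everything else. -/
noncomputable def knnRisk [MeasurableSpace 𝒳] (P : Measure (𝒳 × Bool)) (k : ℕ)
    (D : Fin n → 𝒳 × Bool) : ℝ :=
  (∑ τ : TieBreaker n, P.real {z | knn k D τ z.1 ≠ z.2}) / Fintype.card (TieBreaker n)

/-- Weak consistency of the `k n`-NN classifiers: for an i.i.d. sequence with law `P` whose first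
`n` terms are the training sample, `L_n` converges in probability to `L*`. -/
def WeaklyConsistent [MeasurableSpace 𝒳] (P : Measure (𝒳 × Bool)) [IsProbabilityMeasure P]
    (η : 𝒳 → ℝ) (k : ℕ → ℕ) : Prop :=
  TendstoInMeasure (Measure.infinitePi fun _ : ℕ => P)
    (fun (n : ℕ) (ω : ℕ → 𝒳 × Bool) => knnRisk P (k n) (fun i : Fin n => ω i)) atTop
    (fun _ => bayesRisk P η)

end Classification

end VisualKNN

/-! The theorem combines two independent facts: `k`-NN is weakly consistent on every separable
metric space when the regression function is continuous, and laws with a continuous, compactly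
supported regression function are weakly dense when the space is also locally compact.

Local compactness and separability of `UscFun` come from the embedding into the space of nonempty
compact subsets of the plane. The image is closed, since the conditions characterising hypographs
survive Hausdorff limits (`isClosed_range_hypographCompacts`).

For consistency, `k`-NN is a plug-in rule for `voteShare`, so its excess risk is at most twice the
`L¹` error of that estimate (`risk_sub_bayesRisk_le`). The error at `x` splits into a stochastic
part, a sum of orthogonal residuals with second moment at most `k`, and a bias, at most `ε` once the
ball where `η` varies by at most `ε` holds `k` observations. That this ball holds too few is
controlled by Chebyshev's argument, as `k / n → 0`. The error thus vanishes at every point of the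
support, hence almost everywhere, and dominated convergence integrates this
(`weaklyConsistent_of_continuous`).

For density, the first marginal of `Q` is kept and only its regression function is replaced by a
nearby one in `L¹` (`exists_mem_nhds_continuous_regression`). -/

namespace VisualKNN

/-! ### Topology of the space of hypographs -/

/-- The hypograph of `f`, bundled as a nonempty compact set. -/
noncomputable def hypographCompacts (f : UscFun) :
    TopologicalSpace.NonemptyCompacts (EuclideanSpace ℝ (Fin 2)) :=
  ⟨⟨hypograph f, isCompact_hypograph f⟩, hypograph_nonempty f⟩

theorem isometry_hypographCompacts : Isometry hypographCompacts :=
  Isometry.of_dist_eq fun _ _ => rfl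

theorem mem_hypographCompacts (f : UscFun) (p : EuclideanSpace ℝ (Fin 2)) :
    p ∈ hypographCompacts f ↔ p ∈ hypograph f := Iff.rfl

/-- A compact set containing the base `[0,1] × {0}`, contained in the half strip over it and
closed under moving down is a hypograph. -/
theorem exists_hypographCompacts_eq
    (K : TopologicalSpace.NonemptyCompacts (EuclideanSpace ℝ (Fin 2)))
    (hsub : ∀ p ∈ K, p 0 ∈ Icc (0 : ℝ) 1 ∧ 0 ≤ p 1)
    (hbase : ∀ t ∈ Icc (0 : ℝ) 1, !₂[t, 0] ∈ K)
    (hdown : ∀ p ∈ K, ∀ y, 0 ≤ y → y ≤ p 1 → !₂[p 0, y] ∈ K) :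
    ∃ f, hypographCompacts f = K := by
  -- Vertical sections are compact, so the supremum defining `F` below is attained and its graph
  -- lies in `K`.
  have hcpt : ∀ t : ℝ, IsCompact {y : ℝ | !₂[t, y] ∈ K} := by
    intro t
    have : IsCompact ((fun p : EuclideanSpace ℝ (Fin 2) => p 1) ''
        ((K : Set (EuclideanSpace ℝ (Fin 2))) ∩ {p | p 0 = t})) := by
      refine IsCompact.image (K.isCompact.inter_right ?_) (by fun_prop)
      exact isClosed_eq (by fun_prop) continuous_const
    convert this using 1
    ext y
    constructor
    · intro h
      exact ⟨!₂[t, y], ⟨h, by simp⟩, by simp⟩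
    · rintro ⟨p, ⟨hp, h0⟩, rfl⟩
      have hp' : (!₂[t, p 1] : EuclideanSpace ℝ (Fin 2)) = p := by
        ext i
        fin_cases i <;> simp [show p 0 = t from h0]
      exact hp' ▸ hp
  set F : Icc (0 : ℝ) 1 → ℝ := fun t => sSup {y : ℝ | !₂[(t : ℝ), y] ∈ K} with hF
  have hmem : ∀ t : Icc (0 : ℝ) 1, !₂[(t : ℝ), F t] ∈ K := fun t =>
    (hcpt t).sSup_mem ⟨0, hbase t t.2⟩
  have hle : ∀ (t : Icc (0 : ℝ) 1) (y : ℝ), !₂[(t : ℝ), y] ∈ K → y ≤ F t := fun t y h =>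
    le_csSup (hcpt t).bddAbove h
  have hnn : ∀ t, 0 ≤ F t := fun t => hle t 0 (hbase t t.2)
  have hiff : ∀ (t : Icc (0 : ℝ) 1) (y : ℝ), 0 ≤ y → (y ≤ F t ↔ !₂[(t : ℝ), y] ∈ K) := by
    intro t y hy
    refine ⟨fun h => ?_, hle t y⟩
    have := hdown _ (hmem t) y hy (by simpa using h)
    simpa using this
  have husc : UpperSemicontinuous F := by
    rw [upperSemicontinuous_iff_isClosed_preimage]
    intro a
    -- The horizontal slice of `K` at height `a` describes the superlevel set only for `a ≥ 0`; at
    -- or below zero that set is everything.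
    rcases le_or_gt a 0 with ha | ha
    · convert isClosed_univ
      ext t
      simpa using ha.trans (hnn t)
    · have : F ⁻¹' Ici a = (fun t : Icc (0 : ℝ) 1 => (!₂[(t : ℝ), a] : EuclideanSpace ℝ (Fin 2)))
          ⁻¹' (K : Set (EuclideanSpace ℝ (Fin 2))) := by
        ext t
        exact hiff t a ha.le
      rw [this]
      exact K.isCompact.isClosed.preimage (by fun_prop)
  refine ⟨⟨F, hnn, husc⟩, ?_⟩
  refine SetLike.ext fun p => ?_
  rw [mem_hypographCompacts]
  have hp : p = !₂[p 0, p 1] := by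
    ext i
    fin_cases i <;> simp
  constructor
  · rintro ⟨h, h0, h1⟩
    rw [hp]
    exact (hiff ⟨p 0, h⟩ _ h0).1 h1
  · intro h
    obtain ⟨h0, h1⟩ := hsub p h
    refine ⟨h0, h1, (hiff ⟨p 0, h0⟩ _ h1).2 ?_⟩
    rw [hp] at h
    exact h

/-- Each condition of `exists_hypographCompacts_eq` passes to a Hausdorff limit `K`: points of `K`
are near points of hypographs and conversely, and `K` is closed. -/
theorem isClosed_range_hypographCompacts : IsClosed (range hypographCompacts) := by
  rw [← isSeqClosed_iff_isClosed]
  intro u K hu hlim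
  choose f hf using hu
  obtain rfl : u = fun n => hypographCompacts (f n) := funext fun n => (hf n).symm
  have hclose : ∀ ε > 0, ∃ g : UscFun, dist (hypographCompacts g) K < ε := by
    intro ε hε
    obtain ⟨n, hn⟩ := ((Metric.tendsto_nhds.1 hlim) ε hε).exists
    exact ⟨f n, hn⟩
  have hnear : ∀ {A B : TopologicalSpace.NonemptyCompacts (EuclideanSpace ℝ (Fin 2))} {ε : ℝ},
      dist A B < ε → ∀ p ∈ A, ∃ q ∈ B, dist p q < ε := fun {A B ε} h p hp =>
    Metric.exists_dist_lt_of_hausdorffDist_lt hp h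
      (Metric.hausdorffEDist_ne_top_of_nonempty_of_bounded A.nonempty B.nonempty
        A.isCompact.isBounded B.isCompact.isBounded)
  have hmemK : ∀ p, (∀ ε > 0, ∃ q ∈ K, dist p q < ε) → p ∈ K := by
    intro p h
    have : p ∈ closure (K : Set (EuclideanSpace ℝ (Fin 2))) := Metric.mem_closure_iff.2 h
    rwa [K.isCompact.isClosed.closure_eq] at this
  apply exists_hypographCompacts_eq
  · have hS : IsClosed {p : EuclideanSpace ℝ (Fin 2) | p 0 ∈ Icc (0 : ℝ) 1 ∧ 0 ≤ p 1} :=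
      (isClosed_Icc.preimage
        (by fun_prop : Continuous fun p : EuclideanSpace ℝ (Fin 2) => p 0)).inter
        (isClosed_le continuous_const
          (by fun_prop : Continuous fun p : EuclideanSpace ℝ (Fin 2) => p 1))
    intro p hp
    have : p ∈ closure {p : EuclideanSpace ℝ (Fin 2) | p 0 ∈ Icc (0 : ℝ) 1 ∧ 0 ≤ p 1} := by
      refine Metric.mem_closure_iff.2 fun ε hε => ?_
      obtain ⟨g, hg⟩ := hclose ε hε
      rw [dist_comm] at hg
      obtain ⟨q, ⟨h0, h1, _⟩, hq⟩ := hnear hg p hp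
      exact ⟨q, ⟨h0, h1⟩, hq⟩
    rwa [hS.closure_eq] at this
  · intro t ht
    refine hmemK _ fun ε hε => ?_
    obtain ⟨g, hg⟩ := hclose ε hε
    exact hnear hg _ ((mem_hypograph g ⟨t, ht⟩ 0).2 ⟨le_rfl, g.nonneg _⟩)
  · intro p hp y hy hyp
    refine hmemK _ fun ε hε => ?_
    obtain ⟨g, hg⟩ := hclose (ε / 2) (half_pos hε)
    obtain ⟨q, ⟨h0, h1, h2⟩, hq⟩ := hnear (dist_comm K _ ▸ hg) p hp
    -- Moving `p` down to height `y` is imitated on the nearby point `q` of the hypograph, by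
    -- truncating `q` at height `y`.
    obtain ⟨r, hr, hr'⟩ := hnear hg !₂[q 0, min (q 1) y]
      ((mem_hypograph g ⟨q 0, h0⟩ _).2 ⟨le_min h1 hy, (min_le_left _ _).trans h2⟩)
    refine ⟨r, hr, ?_⟩
    -- Truncating both points at height `y` is nonexpansive, and `y ≤ p 1` makes `y` the truncation
    -- of `p 1`.
    have hd : dist (!₂[p 0, y] : EuclideanSpace ℝ (Fin 2)) !₂[q 0, min (q 1) y] ≤ dist p q := by
      rw [EuclideanSpace.dist_eq, EuclideanSpace.dist_eq]
      refine Real.sqrt_le_sqrt ?_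
      simp only [Fin.sum_univ_two, Real.dist_eq, sq_abs, Matrix.cons_val_zero, Matrix.cons_val_one]
      refine add_le_add le_rfl ?_
      rcases min_cases (q 1) y with ⟨h, h'⟩ | ⟨h, h'⟩ <;> rw [h] <;> nlinarith
    linarith [dist_triangle (!₂[p 0, y] : EuclideanSpace ℝ (Fin 2)) !₂[q 0, min (q 1) y] r]

theorem isClosedEmbedding_hypographCompacts : IsClosedEmbedding hypographCompacts :=
  ⟨isometry_hypographCompacts.isEmbedding, isClosed_range_hypographCompacts⟩

/-- Inherited by closed subspaces from the nonempty compacts of the plane. It is what allows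
approximation by functions of compact support. -/
instance : LocallyCompactSpace UscFun := isClosedEmbedding_hypographCompacts.locallyCompactSpace

instance : SecondCountableTopology UscFun :=
  isClosedEmbedding_hypographCompacts.isEmbedding.secondCountableTopology

/-! ### Combinatorics and measurability of nearest neighbours -/

section Neighbours

/-- Exactly `k` points of a finite family of distinct points have fewer than `k` predecessors. -/
theorem card_filter_card_lt {n k : ℕ} {L : Type*} [LinearOrder L] (f : Fin n → L)
    (hf : Function.Injective f) (hk : k ≤ n) :
    Finset.card {i | Finset.card {j | f j < f i} < k} = k := by
  have hmono : ∀ i j, f i < f j →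
      Finset.card {l | f l < f i} < Finset.card {l | f l < f j} := by
    intro i j hij
    refine Finset.card_lt_card (Finset.ssubset_iff_subset_ne.2 ⟨fun l hl => ?_, fun h => ?_⟩)
    · simp only [Finset.mem_filter, Finset.mem_univ, true_and] at hl ⊢
      exact hl.trans hij
    · have : i ∈ Finset.filter (fun l => f l < f j) Finset.univ := by simpa using hij
      rw [← h] at this
      simp at this
  have hlt : ∀ i, Finset.card {l | f l < f i} < n := by
    intro i
    have : Finset.card {l | f l < f i} < (Finset.univ : Finset (Fin n)).card :=
      Finset.card_lt_card ⟨Finset.subset_univ _, fun h => by simpa using h (Finset.mem_univ i)⟩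
    simpa using this
  -- The rank, the number of predecessors, is an injective self-map of `Fin n`, hence a bijection;
  -- so ranks below `k` are each taken exactly once.
  have hinj : Function.Injective fun i => (⟨_, hlt i⟩ : Fin n) := by
    intro i j hij
    simp only [Fin.mk.injEq] at hij
    by_contra hne
    rcases lt_or_gt_of_ne (hf.ne hne) with h | h
    · exact (hmono _ _ h).ne hij
    · exact (hmono _ _ h).ne hij.symm
  calc Finset.card {i | Finset.card {j | f j < f i} < k}
      = Finset.card {m : Fin n | (m : ℕ) < k} :=
        Finset.card_bijective _ (Finite.injective_iff_bijective.1 hinj) (by simp)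
    _ = k := by simp [Fin.card_filter_val_lt, hk]

variable {𝒳 : Type*} [PseudoMetricSpace 𝒳] {n : ℕ}

theorem closer_iff (D : Fin n → 𝒳 × Bool) (σ : Equiv.Perm (Fin n)) (x : 𝒳) (j i : Fin n) :
    Closer D σ x j i ↔ toLex (dist (D j).1 x, σ j) < toLex (dist (D i).1 x, σ i) := by
  rw [Prod.Lex.toLex_lt_toLex]
  rfl

theorem card_nearest {k : ℕ} (hk : k ≤ n) (D : Fin n → 𝒳 × Bool) (σ : Equiv.Perm (Fin n))
    (x : 𝒳) : (nearest k D σ x).card = k := by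
  classical
  refine Eq.trans ?_ (card_filter_card_lt (fun i => toLex (dist (D i).1 x, σ i)) ?_ hk)
  · unfold nearest
    simp only [closer_iff]
  · intro i j h
    simpa using congrArg (fun p => (ofLex p).2) h

/-- Labels play no part in the choice of neighbours. This is what lets a single label be averaged
out with the neighbours held fixed. -/
theorem nearest_congr (k : ℕ) {D D' : Fin n → 𝒳 × Bool} (h : ∀ i, (D i).1 = (D' i).1)
    (σ : Equiv.Perm (Fin n)) (x : 𝒳) : nearest k D σ x = nearest k D' σ x := by
  unfold nearest Closer
  simp only [h]
  congr!

-- An observation outside the ball has every observation inside it as a strict predecessor, so it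
-- already has at least `k` of them.
open Classical in
theorem dist_lt_of_mem_nearest {k : ℕ} {D : Fin n → 𝒳 × Bool} {σ : Equiv.Perm (Fin n)} {x : 𝒳}
    {δ : ℝ} (h : k ≤ Finset.card {j | dist (D j).1 x < δ}) {i : Fin n}
    (hi : i ∈ nearest k D σ x) : dist (D i).1 x < δ := by
  by_contra! hδ
  simp only [nearest, Finset.mem_filter, Finset.mem_univ, true_and] at hi
  refine absurd hi (not_lt.2 (h.trans (Finset.card_le_card fun j hj => ?_)))
  simp only [Finset.mem_filter, Finset.mem_univ, true_and] at hj ⊢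
  exact Or.inl (hj.trans_le hδ)

theorem votes_true_add_votes_false {k : ℕ} (hk : k ≤ n) (D : Fin n → 𝒳 × Bool)
    (σ : Equiv.Perm (Fin n)) (x : 𝒳) : votes k D σ x true + votes k D σ x false = k := by
  have h := Finset.card_filter_add_card_filter_not (s := nearest k D σ x)
    (fun i => (D i).2 = true)
  rw [card_nearest hk D σ x] at h
  simpa [votes] using h

/-- The proportion of the label `true` among the `k` nearest neighbours. -/
noncomputable def voteShare (k : ℕ) (D : Fin n → 𝒳 × Bool) (σ : Equiv.Perm (Fin n)) (x : 𝒳) : ℝ :=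
  votes k D σ x true / k

/-- With its companion below, this exhibits `knn` as a plug-in rule for `voteShare`. The
inequalities are weak because a tied vote, decided by the coin, has share exactly `1 / 2`. -/
theorem half_le_voteShare {k : ℕ} (hk0 : 0 < k) (hk : k ≤ n) {D : Fin n → 𝒳 × Bool}
    {τ : TieBreaker n} {x : 𝒳} (h : knn k D τ x = true) : 1 / 2 ≤ voteShare k D τ.1 x := by
  have hv := votes_true_add_votes_false hk D τ.1 x
  have : votes k D τ.1 x false ≤ votes k D τ.1 x true := by
    by_contra! hlt
    simp [knn, hlt] at h
  rw [voteShare, div_le_div_iff₀ two_pos (by exact_mod_cast hk0)]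
  exact_mod_cast (by omega : 1 * k ≤ votes k D τ.1 x true * 2)

theorem voteShare_le_half {k : ℕ} (hk0 : 0 < k) (hk : k ≤ n) {D : Fin n → 𝒳 × Bool}
    {τ : TieBreaker n} {x : 𝒳} (h : knn k D τ x = false) : voteShare k D τ.1 x ≤ 1 / 2 := by
  have hv := votes_true_add_votes_false hk D τ.1 x
  have : votes k D τ.1 x true ≤ votes k D τ.1 x false := by
    by_contra! hlt
    simp [knn, hlt, hlt.le.not_gt] at h
  rw [voteShare, div_le_div_iff₀ (by exact_mod_cast hk0) two_pos]
  exact_mod_cast (by omega : votes k D τ.1 x true * 2 ≤ 1 * k)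

variable [MeasurableSpace 𝒳] [OpensMeasurableSpace 𝒳] [SecondCountableTopology 𝒳]

theorem measurableSet_closer (σ : Equiv.Perm (Fin n)) (j i : Fin n) :
    MeasurableSet {q : (Fin n → 𝒳 × Bool) × 𝒳 | Closer q.1 σ q.2 j i} := by
  have hd : ∀ l, Measurable fun q : (Fin n → 𝒳 × Bool) × 𝒳 => dist (q.1 l).1 q.2 := fun l =>
    (measurable_fst.comp ((measurable_pi_apply l).comp measurable_fst)).dist measurable_snd
  exact (measurableSet_lt (hd j) (hd i)).union
    ((measurableSet_eq_fun (hd j) (hd i)).inter (MeasurableSet.const _))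

theorem measurableSet_mem_nearest (k : ℕ) (σ : Equiv.Perm (Fin n)) (i : Fin n) :
    MeasurableSet {q : (Fin n → 𝒳 × Bool) × 𝒳 | i ∈ nearest k q.1 σ q.2} := by
  classical
  simp only [nearest, Finset.mem_filter, Finset.mem_univ, true_and, Finset.card_filter]
  refine measurableSet_lt (Finset.measurable_sum _ fun j _ => ?_) measurable_const
  exact Measurable.ite (measurableSet_closer σ j i) measurable_const measurable_const

theorem measurable_votes (k : ℕ) (σ : Equiv.Perm (Fin n)) (b : Bool) :
    Measurable fun q : (Fin n → 𝒳 × Bool) × 𝒳 => votes k q.1 σ q.2 b := by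
  classical
  have : (fun q : (Fin n → 𝒳 × Bool) × 𝒳 => votes k q.1 σ q.2 b) =
      fun q => ∑ i, if i ∈ nearest k q.1 σ q.2 ∧ (q.1 i).2 = b then 1 else 0 := by
    ext q
    rw [← Finset.card_filter, votes]
    congr 1
    ext i
    simp
  rw [this]
  refine Finset.measurable_sum _ fun i _ => Measurable.ite ?_ measurable_const measurable_const
  refine (measurableSet_mem_nearest k σ i).inter ?_
  exact (measurable_snd.comp ((measurable_pi_apply i).comp measurable_fst))
    (MeasurableSet.singleton b)

theorem measurable_voteShare (k : ℕ) (σ : Equiv.Perm (Fin n)) :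
    Measurable fun q : (Fin n → 𝒳 × Bool) × 𝒳 => voteShare k q.1 σ q.2 :=
  (measurable_from_top.comp (measurable_votes k σ true)).div_const _

theorem measurable_knn (k : ℕ) (τ : TieBreaker n) :
    Measurable fun q : (Fin n → 𝒳 × Bool) × 𝒳 => knn k q.1 τ q.2 :=
  Measurable.ite (measurableSet_lt (measurable_votes k _ _) (measurable_votes k _ _))
    measurable_const (Measurable.ite (measurableSet_lt (measurable_votes k _ _)
      (measurable_votes k _ _)) measurable_const measurable_const)

end Neighbours

/-! ### Excess risk of plug-in rules -/

section Bayes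

/-- The label as a number. -/
def label (b : Bool) : ℝ := if b then 1 else 0

@[simp] theorem label_true : label true = 1 := rfl

@[simp] theorem label_false : label false = 0 := rfl

theorem label_mem (b : Bool) : label b ∈ Icc (0 : ℝ) 1 := by cases b <;> simp

theorem measurable_label : Measurable label := measurable_of_countable _

theorem label_sub_bayesRule_mul_nonneg {𝒳 : Type*} (η : 𝒳 → ℝ) (x : 𝒳) (b : Bool) :
    0 ≤ (label b - label (bayesRule η x)) * (1 - 2 * η x) := by
  by_cases h : 1 / 2 < η x
  · have hb : bayesRule η x = true := by simpa [bayesRule] using h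
    cases b <;> simp only [hb, label_true, label_false] <;> linarith
  · have hb : bayesRule η x = false := by simpa [bayesRule] using h
    cases b <;> simp only [hb, label_true, label_false] <;> linarith

/-- If the two decisions agree, the left side is zero. If they differ, `1 / 2` lies between `e` and
`η x`, so `|1 - 2 * η x|` is at most `2 * |e - η x|`. -/
theorem label_sub_bayesRule_mul_le {𝒳 : Type*} {η : 𝒳 → ℝ} {x : 𝒳} {b : Bool} {e : ℝ} (h1 : b = true → 1 / 2 ≤ e)
    (h0 : b = false → e ≤ 1 / 2) :
    (label b - label (bayesRule η x)) * (1 - 2 * η x) ≤ 2 * |e - η x| := by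
  have hab := abs_le.1 (le_refl |e - η x|)
  by_cases h : 1 / 2 < η x
  · have hb : bayesRule η x = true := by simpa [bayesRule] using h
    cases b
    · have := h0 rfl
      simp only [hb, label_true, label_false]
      linarith
    · simp [hb]
  · have hb : bayesRule η x = false := by simpa [bayesRule] using h
    cases b
    · simp [hb]
    · have := h1 rfl
      simp only [hb, label_true, label_false]
      linarith

variable {𝒳 : Type*} [MeasurableSpace 𝒳] {P : Measure (𝒳 × Bool)} {η : 𝒳 → ℝ}

theorem integrable_of_abs_le {Ω : Type*} [MeasurableSpace Ω] {μ : Measure Ω} [IsFiniteMeasure μ]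
    {f : Ω → ℝ} (hf : Measurable f) {C : ℝ} (h : ∀ x, |f x| ≤ C) : Integrable f μ :=
  .of_bound hf.aestronglyMeasurable C (.of_forall h)

/-- The sigma-algebra generated by the first coordinate. -/
abbrev firstCoord (𝒳 : Type*) [MeasurableSpace 𝒳] : MeasurableSpace (𝒳 × Bool) :=
  MeasurableSpace.comap Prod.fst inferInstance

/-- The residual `Y - η(X)` is orthogonal to every bounded function of `X`. -/
theorem integral_mul_residual [IsProbabilityMeasure P] (hη : IsRegressionFunction P η) (hηm : Measurable η) {h : 𝒳 → ℝ}
    (hm : Measurable h) {C : ℝ} (hC : ∀ x, |h x| ≤ C) :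
    ∫ z, h z.1 * (label z.2 - η z.1) ∂P = 0 := by
  have hmle : firstCoord 𝒳 ≤ Prod.instMeasurableSpace := measurable_fst.comap_le
  have hind : ({z : 𝒳 × Bool | z.2 = true}.indicator fun _ => (1 : ℝ)) = fun z => label z.2 := by
    ext ⟨x, b⟩
    cases b <;> simp
  have hη2 : (fun z : 𝒳 × Bool => η z.1) =ᵐ[P] P[fun z => label z.2 | firstCoord 𝒳] := by
    rw [← hind]
    exact hη.2
  have hlm : Measurable fun z : 𝒳 × Bool => label z.2 := measurable_label.comp measurable_snd
  have hlb : ∀ z : 𝒳 × Bool, |label z.2| ≤ 1 := fun z =>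
    abs_le.2 ⟨by linarith [(label_mem z.2).1], (label_mem z.2).2⟩
  have hηb : ∀ x, |η x| ≤ 1 := fun x =>
    abs_le.2 ⟨by linarith [(hη.1 x).1], (hη.1 x).2⟩
  have hfst : Measurable fun z : 𝒳 × Bool => h z.1 := hm.comp measurable_fst
  have hil : Integrable (fun z : 𝒳 × Bool => label z.2) P := integrable_of_abs_le hlm hlb
  have hb : ∀ (g : 𝒳 × Bool → ℝ), (∀ z, |g z| ≤ 1) → ∀ z, |h z.1 * g z| ≤ C := by
    intro g hg z
    rw [abs_mul]
    calc |h z.1| * |g z| ≤ C * 1 :=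
          mul_le_mul (hC _) (hg z) (abs_nonneg _) ((abs_nonneg _).trans (hC z.1))
      _ = C := mul_one C
  have hi1 : Integrable (fun z : 𝒳 × Bool => h z.1 * label z.2) P :=
    integrable_of_abs_le (hfst.mul hlm) (hb _ hlb)
  have hi2 : Integrable (fun z : 𝒳 × Bool => h z.1 * η z.1) P :=
    integrable_of_abs_le (hfst.mul (hηm.comp measurable_fst)) (hb (fun z => η z.1) fun z => hηb z.1)
  -- A function of the first coordinate can be pulled out of the conditional expectation.
  have hpull : P[(fun z : 𝒳 × Bool => h z.1) * (fun z => label z.2) | firstCoord 𝒳] =ᵐ[P]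
      (fun z : 𝒳 × Bool => h z.1) * P[fun z => label z.2 | firstCoord 𝒳] :=
    condExp_mul_of_stronglyMeasurable_left
      (hm.comp (comap_measurable Prod.fst)).stronglyMeasurable hi1 hil
  have h1 : ∫ z, h z.1 * label z.2 ∂P = ∫ z, h z.1 * η z.1 ∂P := by
    calc ∫ z, h z.1 * label z.2 ∂P
        = ∫ z, (P[(fun z : 𝒳 × Bool => h z.1) * (fun z => label z.2) | firstCoord 𝒳]) z ∂P :=
          (integral_condExp hmle).symm
      _ = ∫ z, h z.1 * η z.1 ∂P := by
          refine integral_congr_ae (hpull.trans ?_)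
          filter_upwards [hη2] with z hz
          simp only [Pi.mul_apply]
          rw [← hz]
  simp only [mul_sub]
  rw [integral_sub hi1 hi2, h1, sub_self]

/-- For `a, b ∈ {0, 1}` the indicator of `a ≠ b` is `a + b - 2ab`. -/
theorem risk_eq_integral {g : 𝒳 → Bool} (hg : Measurable g) :
    P.real {z | g z.1 ≠ z.2} =
      ∫ z, (label (g z.1) + label z.2 - 2 * (label (g z.1) * label z.2)) ∂P := by
  have hS : MeasurableSet {z : 𝒳 × Bool | g z.1 ≠ z.2} :=
    (measurableSet_eq_fun (hg.comp measurable_fst) measurable_snd).compl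
  rw [← integral_indicator_one hS]
  refine integral_congr_ae (.of_forall fun z => ?_)
  rcases z with ⟨x, b⟩
  by_cases h : g x = b
  · cases b <;> simp [h]
    norm_num
  · cases b <;> simp_all

/-- The excess risk of a classifier `g` over another one. -/
theorem risk_sub_risk [IsProbabilityMeasure P] (hη : IsRegressionFunction P η) (hηm : Measurable η) {g g' : 𝒳 → Bool}
    (hg : Measurable g) (hg' : Measurable g') :
    P.real {z | g z.1 ≠ z.2} - P.real {z | g' z.1 ≠ z.2} =
      ∫ z, (label (g z.1) - label (g' z.1)) * (1 - 2 * η z.1) ∂P := by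
  have hl : ∀ b, |label b| ≤ 1 := fun b =>
    abs_le.2 ⟨by linarith [(label_mem b).1], (label_mem b).2⟩
  have hηb : ∀ x, |η x| ≤ 1 := fun x =>
    abs_le.2 ⟨by linarith [(hη.1 x).1], (hη.1 x).2⟩
  have hm : ∀ {f : 𝒳 → Bool}, Measurable f → Measurable fun z : 𝒳 × Bool => label (f z.1) :=
    fun hf => measurable_label.comp (hf.comp measurable_fst)
  have hl2 : Measurable fun z : 𝒳 × Bool => label z.2 := measurable_label.comp measurable_snd
  have hη1 : Measurable fun z : 𝒳 × Bool => η z.1 := hηm.comp measurable_fst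
  have hi : ∀ {f : 𝒳 → Bool}, Measurable f → Integrable
      (fun z : 𝒳 × Bool => label (f z.1) + label z.2 - 2 * (label (f z.1) * label z.2)) P := by
    intro f hf
    refine integrable_of_abs_le (C := 1) (((hm hf).add hl2).sub (((hm hf).mul hl2).const_mul 2)) ?_
    rintro ⟨x, b⟩
    cases b <;> cases f x <;> simp
    norm_num
  rw [risk_eq_integral hg, risk_eq_integral hg', ← integral_sub (hi hg) (hi hg')]
  have h0 := integral_mul_residual hη hηm (h := fun x => label (g x) - label (g' x))
    ((measurable_label.comp hg).sub (measurable_label.comp hg')) (C := 2)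
    (fun x => (abs_sub _ _).trans (by linarith [hl (g x), hl (g' x)]))
  have hd : ∀ z : 𝒳 × Bool, |label (g z.1) - label (g' z.1)| ≤ 2 := fun z =>
    (abs_sub _ _).trans (by linarith [hl (g z.1), hl (g' z.1)])
  have hdm := (hm hg).sub (hm hg')
  have hi1 : Integrable (fun z : 𝒳 × Bool =>
      (label (g z.1) - label (g' z.1)) * (label z.2 - η z.1)) P := by
    refine integrable_of_abs_le (C := 2 * 2) (hdm.mul (hl2.sub hη1)) fun z => ?_
    rw [abs_mul]
    exact mul_le_mul (hd z) ((abs_sub _ _).trans (by linarith [hl z.2, hηb z.1])) (abs_nonneg _)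
      two_pos.le
  have hi2 : Integrable (fun z : 𝒳 × Bool =>
      (label (g z.1) - label (g' z.1)) * (1 - 2 * η z.1)) P := by
    refine integrable_of_abs_le (C := 2 * 1) (hdm.mul ((hη1.const_mul 2).const_sub 1)) fun z => ?_
    rw [abs_mul]
    exact mul_le_mul (hd z) (abs_le.2 ⟨by linarith [(hη.1 z.1).2], by linarith [(hη.1 z.1).1]⟩)
      (abs_nonneg _) two_pos.le
  -- The difference of the losses is `(g - g')(1 - 2Y)`; writing `Y = η + (Y - η)` leaves a residual
  -- term with integral zero.
  calc _ = ∫ z, ((label (g z.1) - label (g' z.1)) * (1 - 2 * η z.1) -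
        2 * ((label (g z.1) - label (g' z.1)) * (label z.2 - η z.1))) ∂P := by
        congr 1
        ext z
        ring
    _ = _ := by rw [integral_sub hi2 (hi1.const_mul 2), integral_const_mul, h0]; ring

theorem measurable_bayesRule (hηm : Measurable η) : Measurable (bayesRule η) := by
  refine measurable_to_bool ?_
  have : bayesRule η ⁻¹' {true} = {x | 1 / 2 < η x} := by
    ext x
    simp [bayesRule]
  rw [this]
  exact measurableSet_lt measurable_const hηm

theorem bayesRisk_le [IsProbabilityMeasure P] (hη : IsRegressionFunction P η) (hηm : Measurable η) {g : 𝒳 → Bool}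
    (hg : Measurable g) : bayesRisk P η ≤ P.real {z | g z.1 ≠ z.2} := by
  rw [← sub_nonneg, bayesRisk, risk_sub_risk hη hηm hg (measurable_bayesRule hηm)]
  exact integral_nonneg fun z => label_sub_bayesRule_mul_nonneg _ _ _

/-- The excess risk of a plug-in rule is at most twice the `L¹` error of the plugged-in estimate. -/
theorem risk_sub_bayesRisk_le [IsProbabilityMeasure P] (hη : IsRegressionFunction P η)
    (hηm : Measurable η) {g : 𝒳 → Bool}
    (hg : Measurable g) {e : 𝒳 → ℝ} (he : Integrable (fun z : 𝒳 × Bool => |e z.1 - η z.1|) P)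
    (h1 : ∀ x, g x = true → 1 / 2 ≤ e x) (h0 : ∀ x, g x = false → e x ≤ 1 / 2) :
    P.real {z | g z.1 ≠ z.2} - bayesRisk P η ≤ 2 * ∫ z, |e z.1 - η z.1| ∂P := by
  rw [bayesRisk, risk_sub_risk hη hηm hg (measurable_bayesRule hηm), ← integral_const_mul]
  exact integral_mono_of_nonneg (.of_forall fun z => label_sub_bayesRule_mul_nonneg _ _ _)
    (he.const_mul 2) (.of_forall fun z => label_sub_bayesRule_mul_le (h1 _) (h0 _))

end Bayes

/-! ### Bias and variance of the vote share at a fixed point -/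

section Variance

/-- A function on a product space whose integral over one coordinate vanishes has integral zero. -/
theorem integral_pi_eq_zero {𝒵 : Type*} [MeasurableSpace 𝒵] {P : Measure 𝒵}
    [IsProbabilityMeasure P] {n : ℕ} (i : Fin n) {F : (Fin n → 𝒵) → ℝ}
    (hF : Integrable F (Measure.pi fun _ => P))
    (h : ∀ D, ∫ z, F (Function.update D i z) ∂P = 0) :
    ∫ D, F D ∂(Measure.pi fun _ => P) = 0 := by
  obtain ⟨m, rfl⟩ : ∃ m, n = m + 1 := ⟨n - 1, by have := i.pos; omega⟩
  have hmp := (measurePreserving_piFinSuccAbove (fun _ : Fin (m + 1) => P) i).symm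
  have hF' : Integrable (fun z => F ((MeasurableEquiv.piFinSuccAbove (fun _ => 𝒵) i).symm z))
      (P.prod (Measure.pi fun _ => P)) :=
    (hmp.integrable_comp_emb (MeasurableEquiv.measurableEmbedding _)).2 hF
  rw [← hmp.integral_comp', integral_prod_symm _ hF']
  -- An arbitrary filler for coordinate `i`, which the update in `h` overwrites.
  obtain ⟨z₀⟩ : Nonempty 𝒵 := nonempty_of_isProbabilityMeasure P
  refine integral_eq_zero_of_ae (.of_forall fun D => ?_)
  have := h (i.insertNth z₀ D)
  simp only [Fin.update_insertNth] at this
  exact this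

/-- The sum of pairwise orthogonal functions. -/
theorem integral_sum_sq_of_orthogonal {Ω ι : Type*} [MeasurableSpace Ω] {μ : Measure Ω} [Fintype ι]
    {f : ι → Ω → ℝ} (hi : ∀ i j, Integrable (fun ω => f i ω * f j ω) μ)
    (ho : ∀ i j, i ≠ j → ∫ ω, f i ω * f j ω ∂μ = 0) :
    ∫ ω, (∑ i, f i ω) ^ 2 ∂μ = ∫ ω, ∑ i, f i ω ^ 2 ∂μ := by
  simp only [sq, Finset.sum_mul_sum]
  rw [integral_finsetSum _ fun i _ => integrable_finsetSum _ fun j _ => hi i j,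
    integral_finsetSum _ fun i _ => hi i i]
  refine Finset.sum_congr rfl fun i _ => ?_
  rw [integral_finsetSum _ fun j _ => hi i j]
  exact Finset.sum_eq_single i (fun j _ hj => ho i j hj.symm) (by simp)

variable {𝒳 : Type*} [PseudoMetricSpace 𝒳] {n : ℕ}

open Classical in
/-- The indicator that the observation `i` is one of the `k` nearest neighbours of `x`. -/
noncomputable def nearWeight (k : ℕ) (D : Fin n → 𝒳 × Bool) (σ : Equiv.Perm (Fin n)) (x : 𝒳)
    (i : Fin n) : ℝ := if i ∈ nearest k D σ x then 1 else 0

/-- The contribution of the observation `i` to the stochastic error of the vote share. -/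
noncomputable def residual (η : 𝒳 → ℝ) (k : ℕ) (σ : Equiv.Perm (Fin n)) (x : 𝒳) (i : Fin n)
    (D : Fin n → 𝒳 × Bool) : ℝ :=
  nearWeight k D σ x i * (label (D i).2 - η (D i).1)

open Classical in
/-- The centred indicator that the observation `i` is in the ball of radius `δ` about `x`. -/
noncomputable def ballDeviation (x : 𝒳) (δ p : ℝ) (i : Fin n) (D : Fin n → 𝒳 × Bool) : ℝ :=
  (if dist (D i).1 x < δ then 1 else 0) - p

theorem nearWeight_mem (k : ℕ) (D : Fin n → 𝒳 × Bool) (σ : Equiv.Perm (Fin n)) (x : 𝒳)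
    (i : Fin n) : nearWeight k D σ x i ∈ Icc (0 : ℝ) 1 := by
  unfold nearWeight
  split_ifs <;> simp

theorem sum_nearWeight {k : ℕ} (hk : k ≤ n) (D : Fin n → 𝒳 × Bool) (σ : Equiv.Perm (Fin n))
    (x : 𝒳) : ∑ i, nearWeight k D σ x i = k := by
  classical
  simp only [nearWeight]
  rw [Finset.sum_boole, Finset.filter_mem_eq_inter, Finset.univ_inter, card_nearest hk]

theorem voteShare_eq (k : ℕ) (D : Fin n → 𝒳 × Bool) (σ : Equiv.Perm (Fin n)) (x : 𝒳) :
    voteShare k D σ x = (∑ i, nearWeight k D σ x i * label (D i).2) / k := by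
  classical
  have : ∀ i, nearWeight k D σ x i * label (D i).2 =
      if i ∈ nearest k D σ x ∧ (D i).2 = true then 1 else 0 := by
    intro i
    by_cases h : i ∈ nearest k D σ x <;> cases hb : (D i).2 <;> simp [nearWeight, h]
  simp only [this, voteShare, votes]
  rw [Finset.sum_boole]
  congr 3
  ext i
  simp

theorem abs_residual_le {η : 𝒳 → ℝ} (hη : ∀ x, η x ∈ Icc (0 : ℝ) 1) (k : ℕ)
    (σ : Equiv.Perm (Fin n)) (x : 𝒳) (i : Fin n) (D : Fin n → 𝒳 × Bool) :
    |residual η k σ x i D| ≤ nearWeight k D σ x i := by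
  have h1 := nearWeight_mem k D σ x i
  rw [residual, abs_mul, abs_of_nonneg h1.1]
  refine mul_le_of_le_one_right h1.1 (abs_le.2 ⟨?_, ?_⟩) <;>
    linarith [(hη (D i).1).1, (hη (D i).1).2, (label_mem (D i).2).1, (label_mem (D i).2).2]

theorem abs_ballDeviation_le {x : 𝒳} {δ p : ℝ} (hp : p ∈ Icc (0 : ℝ) 1) (i : Fin n)
    (D : Fin n → 𝒳 × Bool) : |ballDeviation x δ p i D| ≤ 1 := by
  unfold ballDeviation
  refine abs_le.2 ?_
  split_ifs <;> constructor <;> linarith [hp.1, hp.2]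

/-- Bounds a first moment by a second moment pointwise, in place of the Cauchy–Schwarz inequality.
-/
theorem le_add_sq_div {t ε : ℝ} (hε : 0 < ε) : t ≤ ε + t ^ 2 / ε := by
  rcases le_or_gt t ε with h | h
  · have : 0 ≤ t ^ 2 / ε := by positivity
    linarith
  · have : t ≤ t ^ 2 / ε := by
      rw [le_div_iff₀ hε]
      nlinarith
    linarith

/-- Pointwise bound of the error of the vote share. -/
theorem abs_voteShare_sub_le {η : 𝒳 → ℝ} (hη : ∀ x, η x ∈ Icc (0 : ℝ) 1) {k : ℕ} (hk0 : 0 < k)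
    (hk : k ≤ n) (D : Fin n → 𝒳 × Bool) (σ : Equiv.Perm (Fin n)) {x : 𝒳} {ε δ p : ℝ} (hε : 0 < ε)
    (hδ : ∀ y, dist y x < δ → |η y - η x| ≤ ε) (hkp : 2 * (k : ℝ) ≤ n * p) :
    |voteShare k D σ x - η x| ≤ 2 * ε + (∑ i, residual η k σ x i D) ^ 2 / (k ^ 2 * ε) +
      4 * (∑ i, ballDeviation x δ p i D) ^ 2 / (n * p) ^ 2 := by
  classical
  have hkpos : (0 : ℝ) < k := by exact_mod_cast hk0
  have hnp : 0 < (n : ℝ) * p := by linarith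
  set w := nearWeight k D σ x with hw
  have hsum : ∑ i, w i = k := sum_nearWeight hk D σ x
  have hw0 : ∀ i, 0 ≤ w i := fun i => (nearWeight_mem k D σ x i).1
  set R := ∑ i, residual η k σ x i D with hR
  set C := ∑ i, ballDeviation x δ p i D with hC
  set B := ∑ i, w i * (η (D i).1 - η x) with hB
  -- `R / k` is the stochastic error and `B / k` the bias, since the weights sum to `k`.
  have hdec : voteShare k D σ x - η x = R / k + B / k := by
    rw [voteShare_eq, ← add_div, sub_eq_iff_eq_add, div_add' _ _ _ hkpos.ne']
    congr 1
    have hηk : η x * k = ∑ i, η x * w i := by rw [← hsum, Finset.mul_sum]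
    rw [hR, hB, hηk, ← Finset.sum_add_distrib, ← Finset.sum_add_distrib]
    refine Finset.sum_congr rfl fun i _ => ?_
    rw [residual]
    ring
  have hRk : |R / k| ≤ ε + R ^ 2 / (k ^ 2 * ε) := by
    refine (le_add_sq_div hε).trans_eq ?_
    rw [sq_abs, div_pow, div_div]
  have hBk : ∀ c, (∀ i, w i * |η (D i).1 - η x| ≤ w i * c) → |B / k| ≤ c := by
    intro c hc
    rw [abs_div, abs_of_pos hkpos, div_le_iff₀ hkpos, mul_comm, ← hsum, Finset.sum_mul]
    refine (Finset.abs_sum_le_sum_abs _ _).trans (Finset.sum_le_sum fun i _ => ?_)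
    rw [abs_mul, abs_of_nonneg (hw0 i)]
    exact hc i
  have hR0 : 0 ≤ R ^ 2 / (k ^ 2 * ε) := by positivity
  have hC0 : 0 ≤ 4 * C ^ 2 / (n * p) ^ 2 := by positivity
  rw [hdec]
  refine (abs_add_le _ _).trans ?_
  -- With `k` observations in the ball, every neighbour lies there and the bias is at most `ε`.
  -- Otherwise the bias is bounded by one, and the last term pays for it.
  by_cases hN : k ≤ Finset.card {j | dist (D j).1 x < δ}
  · have : |B / k| ≤ ε := by
      refine hBk ε fun i => ?_
      by_cases hi : i ∈ nearest k D σ x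
      · exact mul_le_mul_of_nonneg_left (hδ _ (dist_lt_of_mem_nearest hN hi)) (hw0 i)
      · simp [hw, nearWeight, hi]
    linarith
  · have h1 : |B / k| ≤ 1 := by
      refine hBk 1 fun i => mul_le_mul_of_nonneg_left (abs_le.2 ⟨?_, ?_⟩) (hw0 i) <;>
        linarith [(hη (D i).1).1, (hη (D i).1).2, (hη x).1, (hη x).2]
    have hCeq : C = (Finset.card {j | dist (D j).1 x < δ} : ℕ) - n * p := by
      simp only [hC, ballDeviation, Finset.sum_sub_distrib, Finset.sum_boole, Finset.sum_const,
        Finset.card_univ, Fintype.card_fin, nsmul_eq_mul]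
    have hNk : ((Finset.card {j | dist (D j).1 x < δ} : ℕ) : ℝ) ≤ k := by
      exact_mod_cast (not_le.1 hN).le
    -- The count is at most `k ≤ n * p / 2`, so it falls short of `n * p` by at least half; this is
    -- the source of the factor `4`.
    have h2 : 1 ≤ 4 * C ^ 2 / (n * p) ^ 2 := by
      rw [le_div_iff₀ (by positivity)]
      have : n * p / 2 ≤ -C := by rw [hCeq]; linarith
      nlinarith
    linarith

variable [MeasurableSpace 𝒳] [OpensMeasurableSpace 𝒳] [SecondCountableTopology 𝒳]

theorem measurable_residual {η : 𝒳 → ℝ} (hη : Measurable η) (k : ℕ) (σ : Equiv.Perm (Fin n))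
    (x : 𝒳) (i : Fin n) : Measurable (residual η k σ x i) := by
  have hD : Measurable fun D : Fin n → 𝒳 × Bool => D i := measurable_pi_apply i
  refine Measurable.mul ?_ ((measurable_label.comp (measurable_snd.comp hD)).sub
    (hη.comp (measurable_fst.comp hD)))
  exact Measurable.ite ((measurable_id.prodMk measurable_const)
    (measurableSet_mem_nearest k σ i)) measurable_const measurable_const

omit [SecondCountableTopology 𝒳] in
theorem measurable_ballDeviation (x : 𝒳) (δ p : ℝ) (i : Fin n) :
    Measurable (ballDeviation x δ p i) := by
  have hD : Measurable fun D : Fin n → 𝒳 × Bool => (D i).1 :=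
    measurable_fst.comp (measurable_pi_apply i)
  refine Measurable.sub_const (Measurable.ite ?_ measurable_const measurable_const) _
  exact hD (Metric.isOpen_ball (x := x) (ε := δ)).measurableSet

variable {P : Measure (𝒳 × Bool)} [IsProbabilityMeasure P] {η : 𝒳 → ℝ}

/-- With all other observations fixed, the weights and the residual of `j` depend on observation `i`
only through its position, whereas `Y_i - η(X_i)` is orthogonal to bounded functions of `X_i`. -/
theorem integral_residual_mul_residual (hη : IsRegressionFunction P η) (hηm : Measurable η) (k : ℕ)
    (σ : Equiv.Perm (Fin n)) (x : 𝒳) {i j : Fin n} (hij : i ≠ j) :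
    ∫ D, residual η k σ x i D * residual η k σ x j D ∂(Measure.pi fun _ => P) = 0 := by
  have hb : ∀ i D, |residual η k σ x i D| ≤ 1 := fun i D =>
    (abs_residual_le hη.1 k σ x i D).trans (nearWeight_mem k D σ x i).2
  refine integral_pi_eq_zero i (integrable_of_abs_le (C := 1 * 1)
    ((measurable_residual hηm k σ x i).mul (measurable_residual hηm k σ x j)) fun D => ?_)
    fun D => ?_
  · rw [abs_mul]
    exact mul_le_mul (hb i D) (hb j D) (abs_nonneg _) zero_le_one
  have hup : Measurable fun y : 𝒳 => Function.update D i (y, true) :=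
    (measurable_update D).comp (measurable_id.prodMk measurable_const)
  have hnm : Measurable fun y : 𝒳 => nearWeight k (Function.update D i (y, true)) σ x i :=
    Measurable.ite ((hup.prodMk measurable_const) (measurableSet_mem_nearest k σ i))
      measurable_const measurable_const
  have hcongr : ∀ z : 𝒳 × Bool, nearest k (Function.update D i z) σ x =
      nearest k (Function.update D i (z.1, true)) σ x := fun z => by
    refine nearest_congr k (fun l => ?_) σ x
    by_cases h : l = i
    · subst h
      simp
    · simp [h]
  rw [← integral_mul_residual hη hηm
    (h := fun y => nearWeight k (Function.update D i (y, true)) σ x i *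
      residual η k σ x j (Function.update D i (y, true))) (C := 1 * 1)
    (hnm.mul ((measurable_residual hηm k σ x j).comp hup))]
  · refine integral_congr_ae (.of_forall fun z => ?_)
    simp only [residual, nearWeight, hcongr z, Function.update_self,
      Function.update_of_ne hij.symm]
    ring
  · intro y
    rw [abs_mul, abs_of_nonneg (nearWeight_mem _ _ _ _ _).1]
    exact mul_le_mul (nearWeight_mem _ _ _ _ _).2 (hb j _) (abs_nonneg _) zero_le_one

omit [SecondCountableTopology 𝒳] in
theorem integral_ballDeviation_mul_ballDeviation (x : 𝒳) (δ : ℝ) {i j : Fin n} (hij : i ≠ j) :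
    ∫ D, ballDeviation x δ (P.real (Prod.fst ⁻¹' Metric.ball x δ)) i D *
      ballDeviation x δ (P.real (Prod.fst ⁻¹' Metric.ball x δ)) j D
        ∂(Measure.pi fun _ => P) = 0 := by
  classical
  set p := P.real (Prod.fst ⁻¹' Metric.ball x δ) with hp
  have hp01 : p ∈ Icc (0 : ℝ) 1 := ⟨measureReal_nonneg, measureReal_le_one⟩
  have hS : MeasurableSet (Prod.fst ⁻¹' Metric.ball x δ : Set (𝒳 × Bool)) :=
    measurable_fst Metric.isOpen_ball.measurableSet
  refine integral_pi_eq_zero i (integrable_of_abs_le (C := 1 * 1)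
    ((measurable_ballDeviation x δ p i).mul (measurable_ballDeviation x δ p j)) fun D => ?_)
    fun D => ?_
  · rw [abs_mul]
    exact mul_le_mul (abs_ballDeviation_le hp01 i D) (abs_ballDeviation_le hp01 j D)
      (abs_nonneg _) zero_le_one
  simp only [ballDeviation, Function.update_self, Function.update_of_ne hij.symm]
  rw [integral_mul_const]
  have : ∫ z : 𝒳 × Bool, ((if dist z.1 x < δ then (1 : ℝ) else 0) - p) ∂P = 0 := by
    have hind : (fun z : 𝒳 × Bool => if dist z.1 x < δ then (1 : ℝ) else 0) =
        (Prod.fst ⁻¹' Metric.ball x δ).indicator 1 := by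
      ext z
      simp [indicator_apply]
    rw [integral_sub (by rw [hind]; exact (integrable_const 1).indicator hS) (integrable_const p),
      hind, integral_indicator_one hS]
    simp [hp]
  rw [this, zero_mul]

/-- The mean error of the vote share at a fixed point. -/
theorem integral_abs_voteShare_sub_le (hη : IsRegressionFunction P η) (hηm : Measurable η) {k : ℕ}
    (hk0 : 0 < k) (hk : k ≤ n) (σ : Equiv.Perm (Fin n)) {x : 𝒳} {ε δ : ℝ} (hε : 0 < ε)
    (hδ : ∀ y, dist y x < δ → |η y - η x| ≤ ε)
    (hp : 0 < P.real (Prod.fst ⁻¹' Metric.ball x δ))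
    (hkp : 2 * (k : ℝ) ≤ n * P.real (Prod.fst ⁻¹' Metric.ball x δ)) :
    ∫ D, |voteShare k D σ x - η x| ∂(Measure.pi fun _ => P) ≤
      2 * ε + 1 / (k * ε) + 4 / (n * P.real (Prod.fst ⁻¹' Metric.ball x δ) ^ 2) := by
  set p := P.real (Prod.fst ⁻¹' Metric.ball x δ) with hpdef
  set ν := Measure.pi fun _ : Fin n => P with hν
  have hp01 : p ∈ Icc (0 : ℝ) 1 := ⟨measureReal_nonneg, measureReal_le_one⟩
  have hkpos : (0 : ℝ) < k := by exact_mod_cast hk0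
  have hnpos : (0 : ℝ) < n := hkpos.trans_le (by exact_mod_cast hk)
  have hrb : ∀ i D, |residual η k σ x i D| ≤ 1 := fun i D =>
    (abs_residual_le hη.1 k σ x i D).trans (nearWeight_mem k D σ x i).2
  have hi : ∀ {f : Fin n → (Fin n → 𝒳 × Bool) → ℝ}, (∀ i, Measurable (f i)) →
      (∀ i D, |f i D| ≤ 1) → ∀ i j, Integrable (fun D => f i D * f j D) ν := by
    intro f hf hb i j
    refine integrable_of_abs_le (C := 1 * 1) ((hf i).mul (hf j)) fun D => ?_
    rw [abs_mul]
    exact mul_le_mul (hb i D) (hb j D) (abs_nonneg _) zero_le_one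
  have hisq : ∀ {f : Fin n → (Fin n → 𝒳 × Bool) → ℝ}, (∀ i, Measurable (f i)) →
      (∀ i D, |f i D| ≤ 1) → Integrable (fun D => (∑ i, f i D) ^ 2) ν := by
    intro f hf hb
    simp only [sq, Finset.sum_mul_sum]
    exact integrable_finsetSum _ fun i _ => integrable_finsetSum _ fun j _ => hi hf hb i j
  have hrm := fun i => measurable_residual hηm k σ x i
  have hbm := fun i => measurable_ballDeviation (n := n) x δ p i
  have hbb := fun (i : Fin n) D => abs_ballDeviation_le (x := x) (δ := δ) hp01 i D
  -- Each squared residual is at most its weight and the weights sum to `k`, so the bound is `k`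
  -- rather than `n`.
  have hR : ∫ D, (∑ i, residual η k σ x i D) ^ 2 ∂ν ≤ k := by
    rw [integral_sum_sq_of_orthogonal (hi hrm hrb)
      fun i j hij => integral_residual_mul_residual hη hηm k σ x hij]
    calc ∫ D, ∑ i, residual η k σ x i D ^ 2 ∂ν ≤ ∫ _, (k : ℝ) ∂ν := by
          refine integral_mono_of_nonneg (.of_forall fun D => by positivity) (integrable_const _)
            (.of_forall fun D => ?_)
          simp only
          rw [← sum_nearWeight hk D σ x]
          refine Finset.sum_le_sum fun i _ => ?_
          rw [← sq_abs]
          nlinarith [abs_residual_le hη.1 k σ x i D, hrb i D, abs_nonneg (residual η k σ x i D)]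
      _ = k := by simp
  have hB : ∫ D, (∑ i, ballDeviation x δ p i D) ^ 2 ∂ν ≤ n := by
    rw [integral_sum_sq_of_orthogonal (hi hbm hbb)
      fun i j hij => integral_ballDeviation_mul_ballDeviation x δ hij]
    calc ∫ D, ∑ i, ballDeviation x δ p i D ^ 2 ∂ν ≤ ∫ _, (n : ℝ) ∂ν := by
          refine integral_mono_of_nonneg (.of_forall fun D => by positivity) (integrable_const _)
            (.of_forall fun D => ?_)
          calc ∑ i, ballDeviation x δ p i D ^ 2 ≤ ∑ _i : Fin n, (1 : ℝ) :=
                Finset.sum_le_sum fun i _ => (sq_le_one_iff_abs_le_one _).2 (hbb i D)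
            _ = n := by simp
      _ = n := by simp
  have hRi := (hisq hrm hrb).div_const ((k : ℝ) ^ 2 * ε)
  have hBi := ((hisq hbm hbb).const_mul 4).div_const ((n * p) ^ 2)
  have hcRi : Integrable
      (fun D => 2 * ε + (∑ i, residual η k σ x i D) ^ 2 / ((k : ℝ) ^ 2 * ε)) ν :=
    (integrable_const _).add hRi
  calc ∫ D, |voteShare k D σ x - η x| ∂ν
      ≤ ∫ D, (2 * ε + (∑ i, residual η k σ x i D) ^ 2 / (k ^ 2 * ε) +
          4 * (∑ i, ballDeviation x δ p i D) ^ 2 / (n * p) ^ 2) ∂ν :=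
        integral_mono_of_nonneg (.of_forall fun D => abs_nonneg _)
          (((integrable_const _).add hRi).add hBi)
          (.of_forall fun D => abs_voteShare_sub_le hη.1 hk0 hk D σ hε hδ hkp)
    _ = 2 * ε + (∫ D, (∑ i, residual η k σ x i D) ^ 2 ∂ν) / (k ^ 2 * ε) +
          4 * (∫ D, (∑ i, ballDeviation x δ p i D) ^ 2 ∂ν) / (n * p) ^ 2 := by
        rw [integral_add hcRi hBi, integral_add (integrable_const _) hRi,
          integral_div, integral_div]
        simp [integral_const_mul]
    _ ≤ 2 * ε + k / (k ^ 2 * ε) + 4 * n / (n * p) ^ 2 := by gcongr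
    _ = 2 * ε + 1 / (k * ε) + 4 / (n * p ^ 2) := by field_simp

end Variance

/-! ### Weak consistency for continuous regression functions -/

section Consistency

variable {𝒳 : Type*} [PseudoMetricSpace 𝒳] [MeasurableSpace 𝒳] {n : ℕ}
  {P : Measure (𝒳 × Bool)} [IsProbabilityMeasure P] {η : 𝒳 → ℝ}

omit [MeasurableSpace 𝒳] in
theorem voteShare_mem {k : ℕ} (hk0 : 0 < k) (hk : k ≤ n) (D : Fin n → 𝒳 × Bool)
    (σ : Equiv.Perm (Fin n)) (x : 𝒳) : voteShare k D σ x ∈ Icc (0 : ℝ) 1 := by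
  have hkpos : (0 : ℝ) < k := by exact_mod_cast hk0
  refine ⟨by unfold voteShare; positivity, ?_⟩
  rw [voteShare, div_le_one hkpos]
  exact_mod_cast (Nat.le_add_right _ _).trans_eq (votes_true_add_votes_false hk D σ x)

omit [MeasurableSpace 𝒳] in
theorem abs_voteShare_sub_le_one (hη : ∀ x, η x ∈ Icc (0 : ℝ) 1) {k : ℕ} (hk0 : 0 < k)
    (hk : k ≤ n) (D : Fin n → 𝒳 × Bool) (σ : Equiv.Perm (Fin n)) (x : 𝒳) :
    |voteShare k D σ x - η x| ≤ 1 := by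
  have h := voteShare_mem hk0 hk D σ x
  exact abs_le.2 ⟨by linarith [h.1, (hη x).2], by linarith [h.2, (hη x).1]⟩

variable (P η) in
/-- The mean absolute error at `x` of the vote share among `k` neighbours in a sample of size `n`,
averaged over the tie breakers. -/
noncomputable def meanError (k n : ℕ) (x : 𝒳) : ℝ :=
  (∑ τ : TieBreaker n, ∫ D, |voteShare k D τ.1 x - η x| ∂(Measure.pi fun _ : Fin n => P)) /
    Fintype.card (TieBreaker n)

theorem sum_div_card_le {ι : Type*} [Fintype ι] [Nonempty ι] {f : ι → ℝ} {c : ℝ}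
    (h : ∀ i, f i ≤ c) : (∑ i, f i) / Fintype.card ι ≤ c := by
  rw [div_le_iff₀ (by exact_mod_cast Fintype.card_pos), mul_comm]
  simpa using Finset.sum_le_card_nsmul Finset.univ f c fun i _ => h i

omit [IsProbabilityMeasure P] in
theorem meanError_le {k n : ℕ} {x : 𝒳} {c : ℝ} (h : ∀ σ : Equiv.Perm (Fin n),
    ∫ D, |voteShare k D σ x - η x| ∂(Measure.pi fun _ : Fin n => P) ≤ c) :
    meanError P η k n x ≤ c :=
  sum_div_card_le fun τ => h τ.1

omit [IsProbabilityMeasure P] in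
theorem meanError_nonneg (k n : ℕ) (x : 𝒳) : 0 ≤ meanError P η k n x :=
  div_nonneg (Finset.sum_nonneg fun _ _ => integral_nonneg fun _ => abs_nonneg _) (Nat.cast_nonneg _)

theorem knnRisk_mem (k : ℕ) (D : Fin n → 𝒳 × Bool) : knnRisk P k D ∈ Icc (0 : ℝ) 1 :=
  ⟨div_nonneg (Finset.sum_nonneg fun _ _ => measureReal_nonneg) (Nat.cast_nonneg _),
    sum_div_card_le fun _ => measureReal_le_one⟩

variable [OpensMeasurableSpace 𝒳] [SecondCountableTopology 𝒳]

omit [IsProbabilityMeasure P] in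
theorem measurable_abs_voteShare_sub (hηm : Measurable η) (k : ℕ) (σ : Equiv.Perm (Fin n)) :
    Measurable fun q : (Fin n → 𝒳 × Bool) × 𝒳 => |voteShare k q.1 σ q.2 - η q.2| :=
  ((measurable_voteShare k σ).sub (hηm.comp measurable_snd)).abs

theorem measurable_meanError (hηm : Measurable η) (k n : ℕ) : Measurable (meanError P η k n) := by
  refine (Finset.measurable_sum _ fun τ _ => ?_).div_const _
  have h : StronglyMeasurable (Function.uncurry fun (x : 𝒳) (D : Fin n → 𝒳 × Bool) =>
      |voteShare k D τ.1 x - η x|) :=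
    ((measurable_abs_voteShare_sub hηm k τ.1).comp measurable_swap).stronglyMeasurable
  exact h.integral_prod_right.measurable

theorem measurable_knnRisk (k : ℕ) : Measurable fun D : Fin n → 𝒳 × Bool => knnRisk P k D := by
  refine (Finset.measurable_sum _ fun τ _ => Measurable.ennreal_toReal ?_).div_const _
  have hS : MeasurableSet {q : (Fin n → 𝒳 × Bool) × (𝒳 × Bool) | knn k q.1 τ q.2.1 ≠ q.2.2} :=
    (measurableSet_eq_fun ((measurable_knn k τ).comp
      (measurable_fst.prodMk (measurable_fst.comp measurable_snd)))
      (measurable_snd.comp measurable_snd)).compl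
  exact measurable_measure_prodMk_left hS

theorem measurable_knn_right (k : ℕ) (D : Fin n → 𝒳 × Bool) (τ : TieBreaker n) :
    Measurable (knn k D τ) := by
  have h := (measurable_knn (𝒳 := 𝒳) k τ).comp (measurable_prodMk_left (x := D))
  exact h

/-- The mean excess risk of the nearest neighbour classifier is at most twice the mean error of
the vote share. -/
theorem integral_abs_knnRisk_sub_le (hη : IsRegressionFunction P η) (hηm : Measurable η) {k : ℕ}
    (hk0 : 0 < k) (hk : k ≤ n) :
    ∫ D : Fin n → 𝒳 × Bool, |knnRisk P k D - bayesRisk P η| ∂(Measure.pi fun _ => P) ≤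
      2 * ∫ z, meanError P η k n z.1 ∂P := by
  set ν := Measure.pi fun _ : Fin n => P with hν
  have hN : (0 : ℝ) < Fintype.card (TieBreaker n) := Nat.cast_pos.2 Fintype.card_pos
  have hmeas : ∀ τ : TieBreaker n, Measurable fun q : (Fin n → 𝒳 × Bool) × (𝒳 × Bool) =>
      |voteShare k q.1 τ.1 q.2.1 - η q.2.1| := fun τ => by
    have hq : Measurable fun q : (Fin n → 𝒳 × Bool) × (𝒳 × Bool) => (q.1, q.2.1) := by fun_prop
    have h := (measurable_abs_voteShare_sub hηm k τ.1).comp hq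
    exact h
  have hb : ∀ (τ : TieBreaker n) (D : Fin n → 𝒳 × Bool) (x : 𝒳),
      |(|voteShare k D τ.1 x - η x|)| ≤ 1 := fun τ D x => by
    rw [abs_abs]
    exact abs_voteShare_sub_le_one hη.1 hk0 hk D τ.1 x
  have hint : ∀ (τ : TieBreaker n) (D : Fin n → 𝒳 × Bool),
      Integrable (fun z : 𝒳 × Bool => |voteShare k D τ.1 z.1 - η z.1|) P := fun τ D => by
    have h := (hmeas τ).comp (measurable_prodMk_left (x := D))
    exact integrable_of_abs_le h fun z => hb τ D z.1
  have hprod : ∀ τ : TieBreaker n, Integrable (fun q : (Fin n → 𝒳 × Bool) × (𝒳 × Bool) =>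
      |voteShare k q.1 τ.1 q.2.1 - η q.2.1|) (ν.prod P) := fun τ =>
    integrable_of_abs_le (hmeas τ) fun q => hb τ q.1 q.2.1
  have hsub : ∀ D : Fin n → 𝒳 × Bool, knnRisk P k D - bayesRisk P η =
      (∑ τ : TieBreaker n, (P.real {z | knn k D τ z.1 ≠ z.2} - bayesRisk P η)) /
        Fintype.card (TieBreaker n) := by
    intro D
    rw [Finset.sum_sub_distrib, sub_div, knnRisk]
    simp only [Finset.sum_const, Finset.card_univ, nsmul_eq_mul]
    rw [mul_div_cancel_left₀ _ hN.ne']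
  have hle : ∀ D : Fin n → 𝒳 × Bool, |knnRisk P k D - bayesRisk P η| ≤
      (∑ τ : TieBreaker n, 2 * ∫ z, |voteShare k D τ.1 z.1 - η z.1| ∂P) /
        Fintype.card (TieBreaker n) := by
    intro D
    rw [hsub, abs_of_nonneg]
    · refine div_le_div_of_nonneg_right (Finset.sum_le_sum fun τ _ => ?_) hN.le
      exact risk_sub_bayesRisk_le hη hηm (measurable_knn_right k D τ) (hint τ D)
        (fun x h => half_le_voteShare hk0 hk h) fun x h => voteShare_le_half hk0 hk h
    · exact div_nonneg (Finset.sum_nonneg fun τ _ =>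
        sub_nonneg.2 (bayesRisk_le hη hηm (measurable_knn_right k D τ))) hN.le
  calc ∫ D, |knnRisk P k D - bayesRisk P η| ∂ν
      ≤ ∫ D, (∑ τ : TieBreaker n, 2 * ∫ z, |voteShare k D τ.1 z.1 - η z.1| ∂P) /
        Fintype.card (TieBreaker n) ∂ν :=
        integral_mono_of_nonneg (.of_forall fun _ => abs_nonneg _)
          ((integrable_finsetSum _ fun τ _ => (hprod τ).integral_prod_left.const_mul 2).div_const _)
          (.of_forall hle)
    -- Fubini: the average over the sample is taken first, at a fixed query point, where the
    -- bias–variance bound applies.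
    _ = (∑ τ : TieBreaker n, 2 * ∫ z, ∫ D, |voteShare k D τ.1 z.1 - η z.1| ∂ν ∂P) /
        Fintype.card (TieBreaker n) := by
        rw [integral_div, integral_finsetSum _ fun τ _ => (hprod τ).integral_prod_left.const_mul 2]
        congr 1
        refine Finset.sum_congr rfl fun τ _ => ?_
        rw [integral_const_mul, integral_integral_swap (hprod τ)]
    _ = 2 * ∫ z, meanError P η k n z.1 ∂P := by
        unfold meanError
        rw [integral_div, integral_finsetSum _ fun τ _ => (hprod τ).integral_prod_right,
          ← Finset.mul_sum, mul_div_assoc]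

/-- The mean error of the vote share tends to zero at every point of the support of the law of the
observations. -/
theorem tendsto_meanError (hη : IsRegressionFunction P η) (hηc : Continuous η) {k : ℕ → ℕ}
    (hk : Tendsto k atTop atTop)
    (hkn : Tendsto (fun n : ℕ => (k n : ℝ) / (n : ℝ)) atTop (𝓝 0)) {x : 𝒳}
    (hx : ∀ δ > 0, 0 < P.real (Prod.fst ⁻¹' Metric.ball x δ)) :
    Tendsto (fun n => meanError P η (k n) n x) atTop (𝓝 0) := by
  rw [Metric.tendsto_nhds]
  intro ε hε
  -- With `ε / 8` here and in the two vanishing terms, the total stays below `2 * (ε / 8) + ε / 8 +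
  -- ε / 8 = ε / 2`.
  obtain ⟨δ, hδ0, hδ⟩ := Metric.continuous_iff.1 hηc x (ε / 8) (by positivity)
  have hp := hx δ hδ0
  set p := P.real (Prod.fst ⁻¹' Metric.ball x δ) with hpdef
  have hp1 : p ≤ 1 := measureReal_le_one
  have hkR : Tendsto (fun n => (k n : ℝ)) atTop atTop := tendsto_natCast_atTop_atTop.comp hk
  have hnR : Tendsto (fun n : ℕ => (n : ℝ)) atTop atTop := tendsto_natCast_atTop_atTop
  have h1 : Tendsto (fun n => 1 / ((k n : ℝ) * (ε / 8))) atTop (𝓝 0) :=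
    (hkR.atTop_mul_const (by positivity)).const_div_atTop 1
  have h2 : Tendsto (fun n : ℕ => 4 / ((n : ℝ) * p ^ 2)) atTop (𝓝 0) :=
    (hnR.atTop_mul_const (by positivity)).const_div_atTop 4
  filter_upwards [h1.eventually_lt_const (show (0 : ℝ) < ε / 8 by positivity),
    h2.eventually_lt_const (show (0 : ℝ) < ε / 8 by positivity), hk.eventually_gt_atTop 0,
    hkn.eventually_lt_const (show (0 : ℝ) < p / 2 by positivity),
    eventually_gt_atTop 0] with n hn1 hn2 hk0 hkn' hn0
  have hnpos : (0 : ℝ) < n := by exact_mod_cast hn0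
  have hkp : 2 * (k n : ℝ) ≤ n * p := by
    rw [div_lt_iff₀ hnpos] at hkn'
    linarith
  have hkle : k n ≤ n := by
    have : (k n : ℝ) ≤ n := by nlinarith
    exact_mod_cast this
  rw [Real.dist_0_eq_abs, abs_of_nonneg (meanError_nonneg _ _ _)]
  refine (meanError_le fun σ => integral_abs_voteShare_sub_le hη hηc.measurable hk0 hkle σ
    (by positivity : 0 < ε / 8) (fun y hy => (hδ y hy).le) hp hkp).trans_lt ?_
  linarith

/-- In a second countable space the support of the marginal has full measure, and every ball about a
point of the support has positive mass. -/
theorem ae_measureReal_ball_pos :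
    ∀ᵐ z ∂P, ∀ δ > 0, 0 < P.real (Prod.fst ⁻¹' Metric.ball z.1 δ) := by
  have h : ∀ᵐ x ∂(P.map Prod.fst), x ∈ (P.map Prod.fst).support := Measure.support_mem_ae
  filter_upwards [ae_of_ae_map measurable_fst.aemeasurable h] with z hz δ hδ
  have := (Measure.mem_support_iff_forall _).1 hz _ (Metric.ball_mem_nhds z.1 hδ)
  rw [Measure.map_apply measurable_fst Metric.isOpen_ball.measurableSet] at this
  exact ENNReal.toReal_pos this.ne' (measure_ne_top _ _)

theorem map_infinitePi_fin {𝒵 : Type*} [MeasurableSpace 𝒵] (P : Measure 𝒵)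
    [IsProbabilityMeasure P] (n : ℕ) :
    (Measure.infinitePi fun _ : ℕ => P).map (fun ω (i : Fin n) => ω i) =
      Measure.pi fun _ : Fin n => P := by
  have h := (iIndepFun_infinitePi (P := fun _ : ℕ => P) (X := fun _ z => z)
    fun _ => measurable_id).precomp (g := fun i : Fin n => (i : ℕ)) Fin.val_injective
  rw [iIndepFun_iff_map_fun_eq_pi_map fun i => (measurable_pi_apply _).aemeasurable] at h
  rw [h]
  congr 1
  ext1 i
  exact Measure.infinitePi_map_eval (fun _ : ℕ => P) i

/-- In a separable metric space the nearest neighbour classifier is weakly consistent whenever the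
regression function is continuous. -/
theorem weaklyConsistent_of_continuous (hη : IsRegressionFunction P η) (hηc : Continuous η)
    {k : ℕ → ℕ} (hk : Tendsto k atTop atTop)
    (hkn : Tendsto (fun n : ℕ => (k n : ℝ) / (n : ℝ)) atTop (𝓝 0)) : WeaklyConsistent P η k := by
  have hηm := hηc.measurable
  have hev : ∀ᶠ n in atTop, 0 < k n ∧ k n ≤ n := by
    filter_upwards [hk.eventually_gt_atTop 0, hkn.eventually_lt_const zero_lt_one,
      eventually_gt_atTop 0] with n h0 h1 hn
    refine ⟨h0, ?_⟩
    rw [div_lt_one (by exact_mod_cast hn)] at h1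
    exact_mod_cast h1.le
  have hlim : Tendsto (fun n => ∫ z, meanError P η (k n) n z.1 ∂P) atTop (𝓝 0) := by
    -- The bound by `1` is available only when `0 < k n ≤ n`, that is, for large `n`; hence the
    -- filter version.
    have := tendsto_integral_filter_of_dominated_convergence (μ := P) (l := atTop)
      (F := fun n z => meanError P η (k n) n z.1) (f := fun _ => 0) (fun _ => 1)
      (.of_forall fun n =>
        ((measurable_meanError hηm (k n) n).comp measurable_fst).aestronglyMeasurable)
      ?_ (integrable_const _) ?_
    · simpa using this
    · filter_upwards [hev] with n hn
      refine .of_forall fun z => ?_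
      rw [Real.norm_eq_abs, abs_of_nonneg (meanError_nonneg _ _ _)]
      refine meanError_le fun σ => ?_
      calc ∫ D, |voteShare (k n) D σ z.1 - η z.1| ∂(Measure.pi fun _ : Fin n => P)
          ≤ ∫ _, (1 : ℝ) ∂(Measure.pi fun _ : Fin n => P) :=
            integral_mono_of_nonneg (.of_forall fun _ => abs_nonneg _) (integrable_const _)
              (.of_forall fun D => abs_voteShare_sub_le_one hη.1 hn.1 hn.2 D σ z.1)
        _ = 1 := by simp
    · filter_upwards [ae_measureReal_ball_pos (P := P)] with z hz
      exact tendsto_meanError hη hηc hk hkn hz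
  have hproj : ∀ n : ℕ, Measurable fun (ω : ℕ → 𝒳 × Bool) (i : Fin n) => ω i := fun n =>
    measurable_pi_lambda _ fun i => measurable_pi_apply _
  have hrm : ∀ n, Measurable fun ω : ℕ → 𝒳 × Bool => knnRisk P (k n) fun i : Fin n => ω i :=
    fun n => (measurable_knnRisk (k n)).comp (hproj n)
  refine tendstoInMeasure_of_tendsto_eLpNorm one_ne_zero (fun n => (hrm n).aestronglyMeasurable)
    aestronglyMeasurable_const ?_
  -- The risk sees only the first `n` terms of the sequence, so its `L¹` distance to the optimal
  -- risk is an integral over the finite product.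
  have heq : ∀ n, eLpNorm ((fun ω : ℕ → 𝒳 × Bool => knnRisk P (k n) fun i : Fin n => ω i) -
      fun _ => bayesRisk P η) 1 (Measure.infinitePi fun _ : ℕ => P) =
      ENNReal.ofReal (∫ D : Fin n → 𝒳 × Bool,
        |knnRisk P (k n) D - bayesRisk P η| ∂(Measure.pi fun _ => P)) := by
    intro n
    have hi : Integrable (fun ω : ℕ → 𝒳 × Bool =>
        (knnRisk P (k n) fun i : Fin n => ω i) - bayesRisk P η)
        (Measure.infinitePi fun _ : ℕ => P) :=
      (integrable_of_abs_le (hrm n) fun ω =>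
        (abs_of_nonneg (knnRisk_mem _ _).1).trans_le (knnRisk_mem _ _).2).sub (integrable_const _)
    rw [eLpNorm_one_eq_lintegral_enorm, ← map_infinitePi_fin P n,
      integral_map (hproj n).aemeasurable
        ((measurable_knnRisk (k n)).sub_const _).abs.aestronglyMeasurable]
    exact (ofReal_integral_norm_eq_lintegral_enorm hi).symm
  simp only [heq]
  rw [← ENNReal.ofReal_zero]
  refine ENNReal.tendsto_ofReal ?_
  refine tendsto_of_tendsto_of_tendsto_of_le_of_le' tendsto_const_nhds
    (by simpa using hlim.const_mul 2) (.of_forall fun n => integral_nonneg fun _ => abs_nonneg _) ?_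
  filter_upwards [hev] with n hn
  exact integral_abs_knnRisk_sub_le hη hηm hn.1 hn.2

end Consistency

/-! ### Density of laws with continuous regression function -/

section Density

variable {𝒳 : Type*} [MeasurableSpace 𝒳] {μ : Measure 𝒳} [IsProbabilityMeasure μ] {η : 𝒳 → ℝ}

/-- The law of `(X, Y)` when `X` has law `μ` and, given `X = x`, the label is `true` with
probability `η x`. -/
noncomputable def lawOfRegression (μ : Measure 𝒳) (η : 𝒳 → ℝ) : Measure (𝒳 × Bool) :=
  (μ.withDensity fun x => ENNReal.ofReal (η x)).map (fun x => (x, true)) +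
    (μ.withDensity fun x => ENNReal.ofReal (1 - η x)).map (fun x => (x, false))

theorem isProbabilityMeasure_lawOfRegression (hη : ∀ x, η x ∈ Icc (0 : ℝ) 1)
    (hηm : Measurable η) : IsProbabilityMeasure (lawOfRegression μ η) := by
  constructor
  rw [lawOfRegression, Measure.add_apply, Measure.map_apply (by fun_prop) MeasurableSet.univ,
    Measure.map_apply (by fun_prop) MeasurableSet.univ, preimage_univ, preimage_univ,
    withDensity_apply _ MeasurableSet.univ, withDensity_apply _ MeasurableSet.univ,
    Measure.restrict_univ, ← lintegral_add_left hηm.ennreal_ofReal]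
  have : ∀ x, ENNReal.ofReal (η x) + ENNReal.ofReal (1 - η x) = 1 := fun x => by
    rw [← ENNReal.ofReal_add (hη x).1 (by linarith [(hη x).2])]
    simp
  simp [this]

theorem integral_lawOfRegression (hη : ∀ x, η x ∈ Icc (0 : ℝ) 1) (hηm : Measurable η)
    {f : 𝒳 × Bool → ℝ} (hf : Measurable f) {C : ℝ} (hC : ∀ z, |f z| ≤ C) :
    ∫ z, f z ∂(lawOfRegression μ η) =
      ∫ x, (η x * f (x, true) + (1 - η x) * f (x, false)) ∂μ := by
  have := isProbabilityMeasure_lawOfRegression (μ := μ) hη hηm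
  have hi : Integrable f (lawOfRegression μ η) := integrable_of_abs_le hf hC
  have h1 : ∀ b : Bool, Measurable fun x : 𝒳 => (x, b) := fun b => by fun_prop
  have hb : ∀ (w : 𝒳 → ℝ) (b : Bool), Measurable w → (∀ x, w x ∈ Icc (0 : ℝ) 1) →
      Integrable (fun x => w x * f (x, b)) μ := by
    intro w b hw hw1
    refine integrable_of_abs_le (C := 1 * C) (hw.mul (hf.comp (h1 b))) fun x => ?_
    rw [abs_mul, abs_of_nonneg (hw1 x).1]
    exact mul_le_mul (hw1 x).2 (hC _) (abs_nonneg _) zero_le_one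
  have hη' : ∀ x, 1 - η x ∈ Icc (0 : ℝ) 1 := fun x =>
    ⟨by linarith [(hη x).2], by linarith [(hη x).1]⟩
  have hd : ∀ (w : 𝒳 → ℝ) (b : Bool), Measurable w → (∀ x, w x ∈ Icc (0 : ℝ) 1) →
      ∫ z, f z ∂((μ.withDensity fun x => ENNReal.ofReal (w x)).map (fun x => (x, b))) =
        ∫ x, w x * f (x, b) ∂μ := by
    intro w b hw hw1
    rw [integral_map (h1 b).aemeasurable hf.aestronglyMeasurable,
      integral_withDensity_eq_integral_toReal_smul hw.ennreal_ofReal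
        (.of_forall fun _ => ENNReal.ofReal_lt_top)]
    simp only [ENNReal.toReal_ofReal (hw1 _).1, smul_eq_mul]
  rw [lawOfRegression] at hi ⊢
  rw [integral_add_measure (integrable_add_measure.1 hi).1 (integrable_add_measure.1 hi).2,
    hd η true hηm hη, hd (fun x => 1 - η x) false (hηm.const_sub 1) hη',
    ← integral_add (hb _ _ hηm hη) (hb _ _ (hηm.const_sub 1) hη')]

/-- The sets to test are the preimages of measurable `A` under the first projection, and there both
integrals equal that of `η` over `A`. -/
theorem isRegressionFunction_lawOfRegression (hη : ∀ x, η x ∈ Icc (0 : ℝ) 1)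
    (hηm : Measurable η) : IsRegressionFunction (lawOfRegression μ η) η := by
  classical
  have := isProbabilityMeasure_lawOfRegression (μ := μ) hη hηm
  refine ⟨hη, ?_⟩
  have hmle : firstCoord 𝒳 ≤ Prod.instMeasurableSpace := measurable_fst.comap_le
  have hηb : ∀ x, |η x| ≤ 1 := fun x => abs_le.2 ⟨by linarith [(hη x).1], (hη x).2⟩
  have hS : MeasurableSet {z : 𝒳 × Bool | z.2 = true} :=
    measurable_snd (MeasurableSet.singleton true)
  have hη1 : Measurable fun z : 𝒳 × Bool => η z.1 := hηm.comp measurable_fst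
  have hηi : Integrable (fun z : 𝒳 × Bool => η z.1) (lawOfRegression μ η) :=
    integrable_of_abs_le hη1 fun z => hηb z.1
  have hSm : Measurable ({z : 𝒳 × Bool | z.2 = true}.indicator fun _ => (1 : ℝ)) :=
    measurable_const.indicator hS
  refine ae_eq_condExp_of_forall_setIntegral_eq hmle ((integrable_const 1).indicator hS)
    (fun s _ _ => hηi.integrableOn) ?_ ?_
  · rintro s ⟨A, hA, rfl⟩ -
    have hAm : MeasurableSet (Prod.fst ⁻¹' A : Set (𝒳 × Bool)) := measurable_fst hA
    rw [← integral_indicator hAm, ← integral_indicator hAm,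
      integral_lawOfRegression (C := 1) hη hηm (hη1.indicator hAm),
      integral_lawOfRegression (C := 1) hη hηm (hSm.indicator hAm)]
    · refine integral_congr_ae (.of_forall fun x => ?_)
      by_cases hx : x ∈ A <;> simp [hx]
      ring
    · intro z
      simp only [indicator_apply]
      split_ifs <;> simp
    · intro z
      simp only [indicator_apply]
      split_ifs
      · exact hηb _
      · simp
  · exact (hηm.comp (comap_measurable Prod.fst)).aestronglyMeasurable

/-- Every law on `𝒳 × Bool` is determined by its first marginal and a regression function. -/
theorem exists_regression (Q : Measure (𝒳 × Bool)) [IsProbabilityMeasure Q] :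
    ∃ η₀ : 𝒳 → ℝ, Measurable η₀ ∧ (∀ x, η₀ x ∈ Icc (0 : ℝ) 1) ∧
      ∀ f : 𝒳 × Bool → ℝ, Integrable f Q →
        ∫ z, f z ∂Q = ∫ x, (η₀ x * f (x, true) + (1 - η₀ x) * f (x, false)) ∂Q.fst := by
  refine ⟨fun x => (Q.condKernel x).real {true},
    (Kernel.measurable_coe _ (MeasurableSet.singleton true)).ennreal_toReal,
    fun x => ⟨measureReal_nonneg, measureReal_le_one⟩, fun f hf => ?_⟩
  rw [← Measure.integral_condKernel hf]
  refine integral_congr_ae (.of_forall fun x => ?_)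
  -- A probability on `Bool` is determined by its mass at `true`, so the disintegration of `Q`
  -- reduces to one function.
  have h1 : (Q.condKernel x).real {false} = 1 - (Q.condKernel x).real {true} := by
    rw [← probReal_compl_eq_one_sub (MeasurableSet.singleton true)]
    congr 1
    ext b
    cases b <;> simp
  simp only
  rw [integral_fintype .of_finite]
  simp [h1]

/-- The integrands differ by `(f (x, false) - f (x, true)) * (η₀ x - η x)`, so closeness of
regression functions in `L¹` of the common marginal gives weak closeness of the laws. -/
theorem abs_integral_lawOfRegression_sub_le {η₀ : 𝒳 → ℝ} (hη : ∀ x, η x ∈ Icc (0 : ℝ) 1)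
    (hηm : Measurable η) (hη₀ : ∀ x, η₀ x ∈ Icc (0 : ℝ) 1) (hη₀m : Measurable η₀)
    {f : 𝒳 × Bool → ℝ} (hf : Measurable f) {C : ℝ} (hC : ∀ z, |f z| ≤ C) :
    |∫ z, f z ∂(lawOfRegression μ η) -
        ∫ x, (η₀ x * f (x, true) + (1 - η₀ x) * f (x, false)) ∂μ| ≤
      2 * C * ∫ x, |η₀ x - η x| ∂μ := by
  rw [integral_lawOfRegression hη hηm hf hC]
  have h1 : ∀ b : Bool, Measurable fun x : 𝒳 => f (x, b) := fun b => hf.comp (by fun_prop)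
  have hi : ∀ w : 𝒳 → ℝ, (∀ x, w x ∈ Icc (0 : ℝ) 1) → Measurable w →
      Integrable (fun x => w x * f (x, true) + (1 - w x) * f (x, false)) μ := by
    intro w hw hwm
    refine integrable_of_abs_le (C := C)
      ((hwm.mul (h1 true)).add ((hwm.const_sub 1).mul (h1 false))) fun x => ?_
    have ht := abs_le.1 (hC (x, true))
    have hf' := abs_le.1 (hC (x, false))
    have hw0 := (hw x).1
    have hw1 : 0 ≤ 1 - w x := by linarith [(hw x).2]
    refine abs_le.2 ⟨?_, ?_⟩
    · nlinarith [mul_le_mul_of_nonneg_left ht.1 hw0, mul_le_mul_of_nonneg_left hf'.1 hw1]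
    · nlinarith [mul_le_mul_of_nonneg_left ht.2 hw0, mul_le_mul_of_nonneg_left hf'.2 hw1]
  rw [← integral_sub (hi η hη hηm) (hi η₀ hη₀ hη₀m), ← integral_const_mul]
  refine (abs_integral_le_integral_abs).trans (integral_mono_of_nonneg
    (.of_forall fun _ => abs_nonneg _) ?_ (.of_forall fun x => ?_))
  · refine (integrable_of_abs_le (C := 1) (hη₀m.sub hηm).abs fun x => ?_).const_mul _
    rw [Pi.sub_apply, abs_abs]
    exact abs_le.2 ⟨by linarith [(hη x).2, (hη₀ x).1], by linarith [(hη x).1, (hη₀ x).2]⟩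
  · have h : η x * f (x, true) + (1 - η x) * f (x, false) -
        (η₀ x * f (x, true) + (1 - η₀ x) * f (x, false)) =
          (f (x, false) - f (x, true)) * (η₀ x - η x) := by ring
    simp only [h, abs_mul]
    refine mul_le_mul_of_nonneg_right ((abs_sub _ _).trans ?_) (abs_nonneg _)
    linarith [hC (x, false), hC (x, true)]

/-- On a locally compact space, a `[0,1]`-valued function is approximated in mean by continuous
`[0,1]`-valued functions of compact support. -/
theorem exists_continuous_hasCompactSupport_approx [TopologicalSpace 𝒳] [BorelSpace 𝒳]
    [R1Space 𝒳] [NormalSpace 𝒳] [WeaklyLocallyCompactSpace 𝒳] [μ.Regular] {η₀ : 𝒳 → ℝ} (hη₀m : Measurable η₀)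
    (hη₀ : ∀ x, η₀ x ∈ Icc (0 : ℝ) 1) {ε : ℝ} (hε : 0 < ε) :
    ∃ η : 𝒳 → ℝ, Continuous η ∧ HasCompactSupport η ∧ (∀ x, η x ∈ Icc (0 : ℝ) 1) ∧
      ∫ x, |η₀ x - η x| ∂μ ≤ ε := by
  have hi : Integrable η₀ μ := integrable_of_abs_le (C := 1) hη₀m fun x =>
    abs_le.2 ⟨by linarith [(hη₀ x).1], (hη₀ x).2⟩
  obtain ⟨g, hgs, hgε, hgc, hgi⟩ := hi.exists_hasCompactSupport_integral_sub_le hε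
  -- Clamping to `[0,1]` fixes `0`, which preserves compact support, and is nonexpansive and fixes
  -- `η₀`, which preserves the error bound.
  refine ⟨fun x => max 0 (min 1 (g x)), by fun_prop,
    hgs.comp_left (g := fun t : ℝ => max 0 (min 1 t)) (by simp),
    fun x => ⟨le_max_left _ _, max_le zero_le_one (min_le_left _ _)⟩, le_trans ?_ hgε⟩
  refine integral_mono_of_nonneg (.of_forall fun _ => abs_nonneg _) (hi.sub hgi).norm
    (.of_forall fun x => ?_)
  obtain ⟨h0, h1⟩ := hη₀ x
  simp only [Real.norm_eq_abs]
  have hp : η₀ x = max 0 (min 1 (η₀ x)) := by rw [min_eq_right h1, max_eq_right h0]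
  nth_rewrite 1 [hp]
  calc |max 0 (min 1 (η₀ x)) - max 0 (min 1 (g x))|
      ≤ |min 1 (η₀ x) - min 1 (g x)| := by
        simpa using abs_max_sub_max_le_max 0 (min 1 (η₀ x)) 0 (min 1 (g x))
    _ ≤ |η₀ x - g x| := by
        simpa using abs_min_sub_min_le_max 1 (η₀ x) 1 (g x)

/-- The laws with a continuous regression function of compact support are dense for the weak
topology. -/
theorem exists_mem_nhds_continuous_regression [TopologicalSpace 𝒳] [BorelSpace 𝒳]
    [SecondCountableTopology 𝒳] [R1Space 𝒳] [NormalSpace 𝒳] [WeaklyLocallyCompactSpace 𝒳]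
    (Q : ProbabilityMeasure (𝒳 × Bool)) [(Q : Measure (𝒳 × Bool)).fst.Regular]
    {U : Set (ProbabilityMeasure (𝒳 × Bool))} (hU : U ∈ 𝓝 Q) :
    ∃ P ∈ U, ∃ η : 𝒳 → ℝ, IsRegressionFunction (P : Measure (𝒳 × Bool)) η ∧ Continuous η ∧
      HasCompactSupport η := by
  obtain ⟨η₀, hη₀m, hη₀, hQ⟩ := exists_regression (Q : Measure (𝒳 × Bool))
  choose η hηc hηs hη01 hηε using fun j : ℕ => exists_continuous_hasCompactSupport_approx
    (μ := (Q : Measure (𝒳 × Bool)).fst) hη₀m hη₀ (Nat.one_div_pos_of_nat (α := ℝ) (n := j))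
  set P : ℕ → ProbabilityMeasure (𝒳 × Bool) := fun j =>
    ⟨lawOfRegression (Q : Measure (𝒳 × Bool)).fst (η j),
      isProbabilityMeasure_lawOfRegression (hη01 j) (hηc j).measurable⟩ with hP
  have hlim : Tendsto P atTop (𝓝 Q) := by
    rw [ProbabilityMeasure.tendsto_iff_forall_integral_tendsto]
    intro f
    have hfm : Measurable f := f.continuous.measurable
    have hfb : ∀ z, |f z| ≤ ‖f‖ := f.norm_coe_le_norm
    rw [tendsto_iff_dist_tendsto_zero]
    refine squeeze_zero (fun _ => dist_nonneg) (fun j => ?_)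
      (by simpa using tendsto_one_div_add_atTop_nhds_zero_nat.const_mul (2 * ‖f‖))
    rw [Real.dist_eq, hQ f (integrable_of_abs_le hfm hfb)]
    refine (abs_integral_lawOfRegression_sub_le (hη01 j) (hηc j).measurable hη₀ hη₀m hfm
      hfb).trans ?_
    exact mul_le_mul_of_nonneg_left ((hηε j).trans_eq (one_div _)) (by positivity)
  obtain ⟨j, hj⟩ := (hlim.eventually hU).exists
  exact ⟨P j, hj, η j, isRegressionFunction_lawOfRegression (hη01 j) (hηc j).measurable, hηc j,
    hηs j⟩

end Density

end VisualKNN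

/-! ### Conclusion: density combined with consistency -/

theorem proposition3 (k : ℕ → ℕ) (hk : Tendsto k atTop atTop)
    (hkn : Tendsto (fun n : ℕ => (k n : ℝ) / (n : ℝ)) atTop (𝓝 0))
    (Q : ProbabilityMeasure (VisualKNN.UscFun × Bool))
    (U : Set (ProbabilityMeasure (VisualKNN.UscFun × Bool))) (hU : U ∈ 𝓝 Q) :
    ∃ P ∈ U, ∃ η : VisualKNN.UscFun → ℝ,
      VisualKNN.IsRegressionFunction (P : Measure (VisualKNN.UscFun × Bool)) η ∧
        Continuous η ∧ HasCompactSupport η ∧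
        VisualKNN.WeaklyConsistent (P : Measure (VisualKNN.UscFun × Bool)) η k := by
  obtain ⟨P, hPU, η, hη, hηc, hηs⟩ := VisualKNN.exists_mem_nhds_continuous_regression Q hU
  exact ⟨P, hPU, η, hη, hηc, hηs, VisualKNN.weaklyConsistent_of_continuous hη hηc hk hkn⟩
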